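/- **LP-type problems.** Let $\mathcal S$ be a finite set of $n\ge 1$ constraints and let $f$ be a function from the subsets of $\mathcal S$ to a totally ordered set $R$. Assume that $(\mathcal S,f)$ is an LP-type problem, that is, * (monotonicity) $f(\mathcal A)\le f(\mathcal B)\le f(\mathcal S)$ for all $\mathcal A\subseteq \mathcal B\subseteq \mathcal S$; * (locality) for all $\mathcal A\subseteq \mathcal B\subseteq \mathcal S$ and $e\in \mathcal S$, if $f(\mathcal A)=f(\mathcal B)=f(\mathcal A\cup\{e\})$ then $f(\mathcal B)=f(\mathcal B\cup\{e\})$; and that every constraint $X\in \mathcal S$ is associated with a set $S_X\subseteq R$ such that, for every $\mathcal A\subseteq \mathcal S$, $f(\mathcal A)$ is the minimal element of $\bigcap_{X\in \mathcal A}S_X$. A basis of $\mathcal T\subseteq \mathcal S$ is a set $\mathcal B\subseteq \mathcal T$ with $f(\mathcal B)=f(\mathcal T)$ and $f(\mathcal B')<f(\mathcal B)$ for all $\mathcal B'\subsetneq \mathcal B$. The combinatorial dimension of $(\mathcal S,f)$ is the maximum cardinality of a basis of a subset of $\mathcal S$; the VC dimension of $(\mathcal S,f)$ is the largest cardinality of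 a finite set $C\subseteq R$ such that every subset of $C$ has the form $C\cap S_X$ with $X\in\mathcal S$. Every constraint is described by $\mathrm{bit}(\mathcal S)$ bits (constraints come from a universe that is injectively coded by bit strings of this length). **MPC model.** The set $\mathcal S$ is partitioned arbitrarily among $k$ machines, $1\le k\le n$. The computation proceeds in rounds; in each round every machine sends a bit string to every machine, which is a function of its own part of the input, its private random seed and all messages that it received in earlier rounds. After the last round every machine outputs an element of $R$. The load is the maximum number of bits sent or received by a machine in a round. The function $f$ on finite subsets of the universe, and numbers $n$, $k$, $\mathrm{bit}(\mathcal S)$, $\delta$, an upper bound $\nu\ge 0$ on the combinatorial dimension and an upper bound $\lambda\ge 1$ on the VC dimension, are known to the protocol; the set $\mathcal S$ and its partition are not. **Theorem.** There is a universal constant $a$, and for every $c\ge 1$ a constant $K$, such that for all such $n,k,\nu,\lambda,\mathrm{bit}(\mathcal S),f$ and every $\delta\in(0,1)$ there is a randomized MPC protocol with at most $K\,\nu/\delta^2$ rounds with the following property. For every LP-type problem $(\mathcal S,f)$ as above with $|\mathcal S|=n$, combinatorial dimension at most $\nu$ and VC dimension at most $\lambda$, and for every partition of $\mathcal S$ among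 the $k$ machines, the load is at most $$K\cdot F\cdot \log(F+2)^a\cdot \mathrm{bit}(\mathcal S),\qquad F=\lambda\, n^{\delta}\,\nu^2,$$ for every choice of the random seeds, and with probability at least $1-1/n^c$ all machines output $f(\mathcal S)$. That is, $f(\mathcal S)$ is computed with high probability in $O(\nu/\delta^2)$ rounds with $\widetilde O(\lambda n^\delta\nu^2)\cdot \mathrm{bit}(\mathcal S)$ load per machine. -/

import Mathlib

universe u v

/-! ### LP-type problems -/

namespace LPType

variable {X : Type u} {R : Type v}

/-- `(S, f)` is an LP-type problem: monotonicity and locality. -/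
structure IsLPType [DecidableEq X] [LinearOrder R] (f : Finset X → R) (S : Finset X) : Prop where
  monotone : ∀ A B : Finset X, A ⊆ B → B ⊆ S → f A ≤ f B ∧ f B ≤ f S
  locality : ∀ A B : Finset X, A ⊆ B → B ⊆ S → ∀ e ∈ S,
    f A = f B → f A = f (insert e A) → f B = f (insert e B)

/-- Every constraint `x` is associated with the set `region x` of the elements of the range that
satisfy it, and `f A` is the minimal element of the intersection of these sets over `A`, for
every `A ⊆ S`. -/
def HasRegions [LinearOrder R] (region : X → Set R) (f : Finset X → R) (S : Finset X) : Prop :=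
  ∀ A : Finset X, A ⊆ S → IsLeast (⋂ x ∈ A, region x) (f A)

/-- `B` is a basis of `T`. -/
def IsBasis [LinearOrder R] (f : Finset X → R) (B T : Finset X) : Prop :=
  B ⊆ T ∧ f B = f T ∧ ∀ B' : Finset X, B' ⊂ B → f B' < f B

open Classical in
/-- The combinatorial dimension of `(S, f)`: the maximum cardinality of a basis (of `S` or of one
of its subfamilies). -/
noncomputable def combDim [LinearOrder R] (f : Finset X → R) (S : Finset X) : ℕ :=
  (S.powerset.filter fun B => ∃ T : Finset X, T ⊆ S ∧ IsBasis f B T).sup Finset.card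

/-- The set family `H` shatters the set `C`: every subset of `C` is cut out by a member of `H`. -/
def Shatters (H : Set (Set R)) (C : Finset R) : Prop :=
  ∀ D : Set R, D ⊆ (C : Set R) → ∃ h ∈ H, h ∩ (C : Set R) = D

/-- The VC dimension of the set system `(H, R)`. -/
noncomputable def vcDim (H : Set (Set R)) : ℕ∞ :=
  ⨆ (C : Finset R) (_ : Shatters H C), (C.card : ℕ∞)

end LPType

/-! ### The MPC model -/

/-- A randomized protocol in the MPC model, for `k` machines, input elements of type `X` and
answers of type `R`.  Each machine has a private random seed, uniform on a finite set.  A history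
is the list of all inboxes that a machine has received so far, most recent first, an inbox being
one bit string (possibly empty) from each machine.  What a machine sends to each machine, and what
it finally outputs, depends on its name, its own part of the input, its own seed and its own
history (the length of the history is the number of the current round). -/
structure MPCProtocol (k : ℕ) (X : Type u) (R : Type v) where
  rounds : ℕ
  Seed : Type
  finite_seed : Finite Seed
  nonempty_seed : Nonempty Seed
  send : Fin k → Finset X → Seed → List (Fin k → List Bool) → Fin k → List Bool
  output : Fin k → Finset X → Seed → List (Fin k → List Bool) → R

namespace MPCProtocol

variable {k : ℕ} {X : Type u} {R : Type v} (P : MPCProtocol k X R)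

/-- The history of machine `i` after `t` rounds, on the input whose `i`-th part is `part i`. -/
def history (part : Fin k → Finset X) (seed : Fin k → P.Seed) :
    ℕ → Fin k → List (Fin k → List Bool)
  | 0, _ => []
  | t + 1, i =>
      (fun j => P.send j (part j) (seed j) (history part seed t j) i) :: history part seed t i

/-- The message from machine `i` to machine `j` in round `t` (rounds are counted from `0`). -/
def message (part : Fin k → Finset X) (seed : Fin k → P.Seed) (t : ℕ) (i j : Fin k) : List Bool :=
  P.send i (part i) (seed i) (P.history part seed t i) j

/-- In every round, every machine sends at most `L` bits and receives at most `L` bits. -/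
def LoadAtMost (part : Fin k → Finset X) (seed : Fin k → P.Seed) (L : ℝ) : Prop :=
  ∀ t < P.rounds, ∀ i : Fin k,
    ((∑ j, (P.message part seed t i j).length : ℕ) : ℝ) ≤ L ∧
    ((∑ j, (P.message part seed t j i).length : ℕ) : ℝ) ≤ L

/-- The output of machine `i` after the last round. -/
def result (part : Fin k → Finset X) (seed : Fin k → P.Seed) (i : Fin k) : R :=
  P.output i (part i) (seed i) (P.history part seed P.rounds i)

/-- The probability, over independent uniform private seeds, that all machines output `r`. -/
noncomputable def successProb (part : Fin k → Finset X) (r : R) : ℝ :=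
  (Nat.card {seed : Fin k → P.Seed // ∀ i, P.result part seed i = r} : ℝ) /
    (Nat.card (Fin k → P.Seed) : ℝ)

end MPCProtocol

/-- `S` is partitioned into the parts `part i`, one for each of the `k` machines. -/
def IsInputPartition {k : ℕ} {X : Type u} (part : Fin k → Finset X) (S : Finset X) : Prop :=
  (∀ i j, i ≠ j → Disjoint (part i) (part j)) ∧ ∀ x, x ∈ S ↔ ∃ i, x ∈ part i

namespace LPType

/-! ### Bases and violated constraints. -/

section Regions

variable {X : Type u} {R : Type v} [LinearOrder R] {region : X → Set R} {f : Finset X → R}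
  {S : Finset X}

/-! The protocol is Clarkson's reweighting method on a tree of machines. All constraints start with
weight 1. An iteration draws about `ν²M` constraints independently, with probability proportional to
weight, and multiplies by `M` the weight of every constraint that the optimum of the sample
violates.

Two estimates of the total weight after `ντ` iterations compete. Among `r + 1` draws at most `ν`
violate the optimum of the others (`HasRegions.card_violators_le`), so by exchangeability the
violated share of the weight is at most `ν / (r + 1)` on average (`sampling_lemma`). Hence an
iteration costs an expected factor of at most `1 + 1/ν` (`sum_weight_cons_le`), and the expected
final weight is at most `3^τ n`. If, however, no sample has the optimum `f S`, then each is violated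
by a member of a fixed basis of `S`; one of these at most `ν` members is violated `τ` times and
alone weighs `M^τ` (`pow_le_sum_weight`). Markov's inequality bounds the failure probability by `n
(3/M)^τ`, which is at most `n^(-c)` for `M` about `n^(δ/2)` and `τ` about `2(c+1)/δ`. Success is
never tested: by monotonicity no sample has an optimum above `f S`, so the maximum of all optima is
output.

The draws are made along an `M`-ary tree of depth about `2/δ`. Each node passes up the weight of its
block and `r` samples from it, and its parent picks a child in proportion to weight for each sample
(`card_treeSample`). The root's sample then travels down, and every machine reweights its own
constraints locally (`stateAt_iteration`). A node handles `M` messages, each dominated by `ν²M`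
constraints, which gives load of order `ν² n^δ` times the bit length. -/

lemma HasRegions.mem_region (h : HasRegions region f S) {A : Finset X} (hA : A ⊆ S) {x : X}
    (hx : x ∈ A) : f A ∈ region x :=
  Set.mem_iInter₂.1 (h A hA).1 x hx

lemma HasRegions.le_of_forall_mem (h : HasRegions region f S) {A : Finset X} (hA : A ⊆ S) {v : R}
    (hv : ∀ x ∈ A, v ∈ region x) : f A ≤ v :=
  (h A hA).2 (Set.mem_iInter₂.2 hv)

lemma HasRegions.mono (h : HasRegions region f S) {A B : Finset X} (hAB : A ⊆ B) (hB : B ⊆ S) :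
    f A ≤ f B :=
  h.le_of_forall_mem (hAB.trans hB) fun _ hx => h.mem_region hB (hAB hx)

/-- A subset of least cardinality with the value `f T` is a basis, since by monotonicity a proper
subset can only have a smaller value. -/
lemma HasRegions.exists_isBasis (h : HasRegions region f S) {T : Finset X} (hT : T ⊆ S) :
    ∃ B, IsBasis f B T ∧ B.card ≤ combDim f S := by
  classical
  obtain ⟨B, hB, hmin⟩ := Finset.exists_min_image (T.powerset.filter fun B => f B = f T)
    Finset.card ⟨T, by simp⟩
  simp only [Finset.mem_filter, Finset.mem_powerset, and_imp] at hB hmin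
  have hb : IsBasis f B T := by
    refine ⟨hB.1, hB.2, fun B' hB' => ?_⟩
    refine lt_of_le_of_ne (h.mono hB'.subset (hB.1.trans hT)) fun he => ?_
    exact absurd (Finset.card_lt_card hB')
      (not_lt.2 (hmin B' (hB'.subset.trans hB.1) (he.trans hB.2)))
  refine ⟨B, hb, ?_⟩
  unfold combDim
  refine Finset.le_sup (f := Finset.card) ?_
  rw [Finset.mem_filter, Finset.mem_powerset]
  exact ⟨hB.1.trans hT, T, hT, hb⟩

open Classical in
/-- At most `combDim f S` members of a finite family violate the optimum of the remaining ones. -/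
lemma HasRegions.card_violators_le (h : HasRegions region f S) {ι : Type*} [Fintype ι]
    (y : ι → X) (hy : ∀ i, y i ∈ S) :
    (Finset.univ.filter fun i => f ((Finset.univ.erase i).image y) ∉ region (y i)).card
      ≤ combDim f S := by
  have hsub : ∀ s : Finset ι, s.image y ⊆ S := fun s x hx => by
    obtain ⟨i, -, rfl⟩ := Finset.mem_image.1 hx
    exact hy i
  obtain ⟨B, hB, hcard⟩ := h.exists_isBasis (hsub Finset.univ)
  -- The family may repeat constraints, but a violator occurs only once in it, so that `y` is
  -- injective on violators. Below, each violator is shown to lie in a basis `B` of the whole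
  -- family.
  have hnot : ∀ i, f ((Finset.univ.erase i).image y) ∉ region (y i) →
      y i ∉ (Finset.univ.erase i).image y :=
    fun i hi hmem => hi (h.mem_region (hsub _) hmem)
  refine le_trans (Finset.card_le_card_of_injOn y ?_ ?_) hcard
  · intro i hi
    have hi' := (Finset.mem_filter.1 hi).2
    by_contra hiB
    have hBsub : B ⊆ (Finset.univ.erase i).image y := fun x hx => by
      obtain ⟨j, -, rfl⟩ := Finset.mem_image.1 (hB.1 hx)
      exact Finset.mem_image_of_mem _
        (Finset.mem_erase.2 ⟨fun hji => hiB (hji ▸ hx), Finset.mem_univ _⟩)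
    have h1 : f ((Finset.univ.erase i).image y) = f (Finset.univ.image y) :=
      le_antisymm (h.mono (Finset.image_subset_image (Finset.erase_subset _ _)) (hsub _))
        (hB.2.1 ▸ h.mono hBsub (hsub _))
    exact hi' (h1 ▸ h.mem_region (hsub _) (Finset.mem_image_of_mem _ (Finset.mem_univ i)))
  · intro i hi j hj hij
    by_contra hne
    exact hnot i (Finset.mem_filter.1 hi).2
      (hij ▸ Finset.mem_image_of_mem _ (Finset.mem_erase.2 ⟨Ne.symm hne, Finset.mem_univ _⟩))

end Regions

end LPType

namespace MPCSampling

/-! ### Averages over uniform seeds and exact weighted choice. -/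

section Counting

/-- Refreshing one coordinate of a uniformly random vector does not change averages. -/
lemma sum_sum_update {ι U : Type*} [Fintype ι] [DecidableEq ι] [Fintype U] (g : (ι → U) → ℕ)
    (a : ι) :
    ∑ η : ι → U, ∑ u : U, g (Function.update η a u) = Fintype.card U * ∑ η : ι → U, g η := by
  -- Exchanging coordinate `a` with the fresh value is an involution.
  let e : (ι → U) × U → (ι → U) × U := fun p => (Function.update p.1 a p.2, p.1 a)
  have he : Function.Involutive e := fun p => by
    simp [e]
  calc ∑ η : ι → U, ∑ u : U, g (Function.update η a u)
      = ∑ p : (ι → U) × U, g (he.toPerm e p).1 := by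
        rw [Fintype.sum_prod_type]; rfl
    _ = ∑ p : (ι → U) × U, g p.1 := Equiv.sum_comp (he.toPerm e) fun p => g p.1
    _ = _ := by
        rw [Fintype.sum_prod_type]
        simp [Finset.mul_sum]

/-- Every positive total weight up to `N` divides `N!`, so a single seed space realises all the
required probabilities exactly. If the total is zero, the equation reads `0 = 0`. -/
lemma exists_pick {ι : Type*} [Fintype ι] [Nonempty ι] (N : ℕ) (w : ι → ℕ) :
    ∃ p : Fin N.factorial → ι, ∑ i, w i ≤ N → ∀ c,
      Nat.card {u // p u = c} * ∑ i, w i = N.factorial * w c := by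
  rcases Nat.eq_zero_or_pos (∑ i, w i) with h0 | hpos
  · refine ⟨fun _ => Classical.arbitrary ι, fun _ c => ?_⟩
    rw [h0, Finset.sum_eq_zero_iff.1 h0 c (Finset.mem_univ c)]
    simp
  by_cases h : ∑ i, w i ≤ N
  · obtain ⟨q, hq⟩ := Nat.dvd_factorial hpos h
    have hc : Fintype.card (Fin N.factorial) = Fintype.card (Σ i, Fin (q * w i)) := by
      simp [hq, ← Finset.mul_sum, mul_comm]
    let e := Fintype.equivOfCardEq hc
    refine ⟨fun u => (e u).1, fun _ c => ?_⟩
    have e1 : {u // (e u).1 = c} ≃ {s : Σ i, Fin (q * w i) // s.1 = c} :=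
      e.subtypeEquiv fun _ => Iff.rfl
    rw [Nat.card_congr (e1.trans (Equiv.sigmaSubtype c)), Nat.card_fin, hq]
    ring
  · exact ⟨fun _ => Classical.arbitrary ι, fun h' => absurd h' h⟩

/-- A choice of an index with probability proportional to the weights `w`, from a uniformly
random seed in `Fin N.factorial`, if the total weight is at most `N`. -/
noncomputable def pick {ι : Type*} [Fintype ι] [Nonempty ι] (N : ℕ) (w : ι → ℕ) :
    Fin N.factorial → ι :=
  (exists_pick N w).choose

lemma card_pick {ι : Type*} [Fintype ι] [Nonempty ι] [DecidableEq ι] {N : ℕ} {w : ι → ℕ}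
    (h : ∑ i, w i ≤ N) (c : ι) :
    (∑ u, if pick N w u = c then 1 else 0) * ∑ i, w i = N.factorial * w c := by
  rw [← (exists_pick N w).choose_spec h c]
  rw [Finset.sum_boole, Nat.card_eq_fintype_card, Fintype.card_subtype, Nat.cast_id]
  rfl

end Counting

/-! ### The sampling lemma. -/

section SamplingLemma

open Classical in
/-- The sampling lemma: the expected weight of the constraints that violate the optimum of `r`
independent weighted samples is at most `ν / (r + 1)` of the total weight. -/
lemma sampling_lemma {X : Type u} {R : Type v} [LinearOrder R] {region : X → Set R}
    {f : Finset X → R} {S : Finset X} (h : LPType.HasRegions region f S) {ν : ℕ}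
    (hν : LPType.combDim f S ≤ ν) {Ω : Type*} [Fintype Ω] [Nonempty Ω] (G : Ω → X)
    (hG : ∀ η, G η ∈ S)
    (w : X → ℕ) (W : ℕ) (hw : ∀ x ∈ S, (∑ η, if G η = x then 1 else 0) * W = Fintype.card Ω * w x)
    (r : ℕ) :
    (r + 1) * ∑ ω : Fin r → Ω,
        ∑ x ∈ S with f (Finset.univ.image fun q => G (ω q)) ∉ region x, w x
      ≤ ν * W * Fintype.card (Fin r → Ω) := by
  -- Indicator that draw `i` violates the optimum of the other `r` draws.
  let A : Fin (r + 1) → (Fin (r + 1) → Ω) → ℕ := fun i z =>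
    if f ((Finset.univ.erase i).image fun j => G (z j)) ∉ region (G (z i)) then 1 else 0
  have hA : ∀ z, ∑ i, A i z ≤ ν := fun z => by
    have := h.card_violators_le (fun j => G (z j)) (fun j => hG _)
    simp only [A, Finset.sum_boole, Nat.cast_id]
    refine le_trans (le_of_eq ?_) (this.trans hν)
    congr!
  have hsymm : ∀ i, ∑ z, A i z = ∑ z, A 0 z := fun i => by
    rw [← Equiv.sum_comp (Equiv.arrowCongr (Equiv.swap 0 i) (Equiv.refl Ω)) (A i)]
    refine Finset.sum_congr rfl fun z _ => ?_
    have h1 : (Finset.univ.erase i).image (fun j => G (z (Equiv.swap 0 i j)))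
        = (Finset.univ.erase 0).image (fun j => G (z j)) := by
      ext x
      simp only [Finset.mem_image, Finset.mem_erase, Finset.mem_univ, and_true]
      constructor
      · rintro ⟨j, hj, rfl⟩
        exact ⟨_, fun h0 => hj (by simpa using (Equiv.swap_apply_eq_iff.1 h0)), rfl⟩
      · rintro ⟨j, hj, rfl⟩
        exact ⟨Equiv.swap 0 i j, fun h0 => hj (by simpa using (Equiv.swap_apply_eq_iff.1 h0)),
          by simp⟩
    simp only [A, Equiv.arrowCongr_apply, Function.comp_def, Equiv.symm_swap, Equiv.refl_apply,
      Equiv.swap_apply_right, h1]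
  have hsum : (r + 1) * ∑ z, A 0 z ≤ ν * Fintype.card (Fin (r + 1) → Ω) := by
    calc (r + 1) * ∑ z, A 0 z = ∑ i, ∑ z, A i z := by simp [hsymm]
      _ = ∑ z, ∑ i, A i z := Finset.sum_comm
      _ ≤ ∑ _z : Fin (r + 1) → Ω, ν := Finset.sum_le_sum fun z _ => hA z
      _ = _ := by simp [mul_comm]
  -- Draw `0` becomes a fresh test draw against the sample formed by the other `r`.
  have hcons : ∑ z, A 0 z = ∑ ω : Fin r → Ω, ∑ η : Ω,
      if f (Finset.univ.image fun q => G (ω q)) ∉ region (G η) then 1 else 0 := by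
    rw [← Equiv.sum_comp (Fin.consEquiv fun _ => Ω) (A 0), Fintype.sum_prod_type,
      Finset.sum_comm]
    refine Finset.sum_congr rfl fun ω _ => Finset.sum_congr rfl fun η _ => ?_
    have h1 : (Finset.univ.erase (0 : Fin (r + 1))).image
        (fun j => G ((Fin.cons η ω : Fin (r + 1) → Ω) j))
        = Finset.univ.image fun q => G (ω q) := by
      ext x
      simp only [Finset.mem_image, Finset.mem_erase, Finset.mem_univ, and_true, true_and]
      constructor
      · rintro ⟨j, hj, rfl⟩
        obtain ⟨q, rfl⟩ := Fin.exists_succ_eq.2 hj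
        exact ⟨q, by simp⟩
      · rintro ⟨q, rfl⟩
        exact ⟨q.succ, Fin.succ_ne_zero q, by simp⟩
    simp only [A, Fin.consEquiv_apply, h1, Fin.cons_zero]
  -- The probability that the test draw violates is the violated share of the total weight.
  have hinner : ∀ T : Finset X, Fintype.card Ω * ∑ x ∈ S with f T ∉ region x, w x
      = W * ∑ η : Ω, if f T ∉ region (G η) then 1 else 0 := fun T => by
    calc Fintype.card Ω * ∑ x ∈ S with f T ∉ region x, w x
        = ∑ x ∈ S with f T ∉ region x, W * ∑ η, if G η = x then 1 else 0 := by
          rw [Finset.mul_sum]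
          refine Finset.sum_congr rfl fun x hx => ?_
          rw [← hw x (Finset.mem_filter.1 hx).1, mul_comm]
      _ = W * ∑ x ∈ S with f T ∉ region x, ∑ η : Ω, if G η = x then 1 else 0 := by
          rw [← Finset.mul_sum]
      _ = _ := by
          rw [Finset.sum_comm]
          refine congrArg _ (Finset.sum_congr rfl fun η _ => ?_)
          simp [hG η]
  refine Nat.le_of_mul_le_mul_left ?_ (Fintype.card_pos (α := Ω))
  calc Fintype.card Ω * ((r + 1) * ∑ ω : Fin r → Ω,
        ∑ x ∈ S with f (Finset.univ.image fun q => G (ω q)) ∉ region x, w x)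
      = (r + 1) * ∑ ω : Fin r → Ω, Fintype.card Ω *
        ∑ x ∈ S with f (Finset.univ.image fun q => G (ω q)) ∉ region x, w x := by
        rw [← Finset.mul_sum]; ring
    _ = W * ((r + 1) * ∑ z, A 0 z) := by
        simp only [hinner]
        rw [← Finset.mul_sum, hcons]; ring
    _ ≤ W * (ν * Fintype.card (Fin (r + 1) → Ω)) := Nat.mul_le_mul_left _ hsum
    _ = _ := by
        simp [pow_succ]; ring

end SamplingLemma
-- Weighted sampling along an aggregation tree.
section Tree

variable {X : Type u} {k : ℕ} (parent : Fin k → Fin k) (part : Fin k → Finset X) (w : X → ℕ)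

open Classical in
/-- The weight of the constraint `x` in the block that node `i` represents at level `l` of the
aggregation tree. -/
noncomputable def treeWeight : ℕ → Fin k → X → ℕ
  | 0, i, x => if x ∈ part i then w x else 0
  | l + 1, i, x => ∑ c, if parent c = i then treeWeight l c x else 0

/-- Unrolls the recursion: the block of `i` at level `l` consists of the parts of all machines whose
`l`-th ancestor is `i`. -/
lemma treeWeight_eq (l : ℕ) (i : Fin k) (x : X) :
    treeWeight parent part w l i x =
      ∑ j, if parent^[l] j = i then treeWeight parent part w 0 j x else 0 := by
  induction l generalizing i with
  | zero => rw [Finset.sum_eq_single i] <;> simp +contextual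
  | succ l ih =>
    rw [treeWeight]
    simp only [ih, Function.iterate_succ_apply']
    simp only [← Finset.sum_filter, Finset.sum_sigma']
    refine Finset.sum_nbij' (fun p => p.2) (fun j => ⟨parent^[l] j, j⟩) ?_ ?_ ?_ ?_ ?_ <;>
      simp +contextual

lemma sum_treeWeight_zero {S : Finset X} (hpart : IsInputPartition part S) (x : X) :
    ∑ j, treeWeight parent part w 0 j x = Set.indicator (S : Set X) w x := by
  classical
  simp only [treeWeight]
  by_cases hx : x ∈ S
  · obtain ⟨i, hi⟩ := (hpart.2 x).1 hx
    rw [Finset.sum_eq_single i]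
    · simp [hi, hx]
    · intro j _ hji
      rw [if_neg fun hj => Finset.disjoint_left.1 (hpart.1 j i hji) hj hi]
    · simp
  · rw [Set.indicator_of_notMem (by simpa using hx)]
    exact Finset.sum_eq_zero fun j _ => if_neg fun hj => hx ((hpart.2 x).2 ⟨j, hj⟩)

lemma treeWeight_le {S : Finset X} (hpart : IsInputPartition part S) (l : ℕ) (i : Fin k) (x : X) :
    treeWeight parent part w l i x ≤ Set.indicator (S : Set X) w x := by
  rw [treeWeight_eq, ← sum_treeWeight_zero parent part w hpart]
  exact Finset.sum_le_sum fun j _ => by split_ifs <;> simp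

lemma treeWeight_root {S : Finset X} (hpart : IsInputPartition part S) {l : ℕ} {i : Fin k}
    (hroot : ∀ j, parent^[l] j = i) (x : X) :
    treeWeight parent part w l i x = Set.indicator (S : Set X) w x := by
  rw [treeWeight_eq, ← sum_treeWeight_zero parent part w hpart]
  simp [hroot]

variable [Fintype X]

lemma sum_treeWeight_le {S : Finset X} (hpart : IsInputPartition part S) (l : ℕ) (i : Fin k) :
    ∑ x, treeWeight parent part w l i x ≤ ∑ x ∈ S, w x := by
  classical
  refine (Finset.sum_le_sum fun x _ => treeWeight_le parent part w hpart l i x).trans ?_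
  simp [Set.indicator_apply, Finset.sum_ite_mem]

lemma sum_treeWeight_root {S : Finset X} (hpart : IsInputPartition part S) {l : ℕ} {i : Fin k}
    (hroot : ∀ j, parent^[l] j = i) :
    ∑ x, treeWeight parent part w l i x = ∑ x ∈ S, w x := by
  classical
  simp [treeWeight_root parent part w hpart hroot, Set.indicator_apply, Finset.sum_ite_mem]

lemma sum_treeWeight_succ (l : ℕ) (i : Fin k) :
    ∑ x, treeWeight parent part w (l + 1) i x
      = ∑ c, if parent c = i then ∑ x, treeWeight parent part w l c x else 0 := by
  simp only [treeWeight]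
  rw [Finset.sum_comm]
  exact Finset.sum_congr rfl fun c _ => by split_ifs <;> simp

variable [NeZero k] [Nonempty X] (N D : ℕ)

/-- The constraint that node `i` has drawn from its block at level `l`, if `η` holds the random
seeds: a child is drawn with probability proportional to the weight of its block, and the
constraint drawn by this child is taken over. -/
noncomputable def treeSample (η : Fin k × Fin (D + 1) → Fin N.factorial) : ℕ → Fin k → X
  | 0, i => pick N (treeWeight parent part w 0 i) (η (i, 0))
  | l + 1, i =>
      let c := pick N (fun c => if parent c = i then ∑ x, treeWeight parent part w l c x else 0)
        (η (i, Fin.ofNat (D + 1) (l + 1)))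
      if parent c = i then treeSample η l c else Classical.arbitrary X

/-- A sample at level `l` reads only seeds of levels at most `l`. This makes the choice of a child
independent of what the children have drawn. -/
lemma treeSample_update (η : Fin k × Fin (D + 1) → Fin N.factorial) (i : Fin k) (l' : Fin (D + 1))
    (u : Fin N.factorial) (l : ℕ) (hl : l < l') (c : Fin k) :
    treeSample parent part w N D (Function.update η (i, l') u) l c
      = treeSample parent part w N D η l c := by
  induction l generalizing c with
  | zero =>
    have h0 : ((c, 0) : Fin k × Fin (D + 1)) ≠ (i, l') := fun h => by
      have := congrArg (fun p => (p.2 : ℕ)) h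
      simp at this; omega
    simp [treeSample, h0]
  | succ l ih =>
    have h0 : ((c, Fin.ofNat (D + 1) (l + 1)) : Fin k × Fin (D + 1)) ≠ (i, l') := fun h => by
      have := congrArg (fun p => (p.2 : ℕ)) h
      simp only [Fin.val_ofNat] at this
      rw [Nat.mod_eq_of_lt (by omega)] at this; omega
    simp only [treeSample, Function.update_of_ne h0, ih (by omega)]

open Classical in
/-- The sample drawn at level `l` of the aggregation tree follows the weights exactly. -/
lemma card_treeSample (hm : ∀ l i, ∑ x, treeWeight parent part w l i x ≤ N)
    (l : ℕ) (hl : l ≤ D) (i : Fin k) (x : X) :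
    (∑ η, if treeSample parent part w N D η l i = x then 1 else 0)
        * ∑ y, treeWeight parent part w l i y
      = Fintype.card (Fin k × Fin (D + 1) → Fin N.factorial) * treeWeight parent part w l i x := by
  have hm0 : 0 < N.factorial := N.factorial_pos
  induction l generalizing i with
  | zero =>
    have key := sum_sum_update
      (fun η => if treeSample parent part w N D η 0 i = x then 1 else 0) (i, (0 : Fin (D + 1)))
    have h2 : ∀ η u, treeSample parent part w N D (Function.update η (i, (0 : Fin (D + 1))) u) 0 i
        = pick N (treeWeight parent part w 0 i) u := fun η u => by simp [treeSample]
    simp only [h2, Fintype.card_fin, Finset.sum_const, smul_eq_mul, Finset.card_univ] at key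
    refine Nat.eq_of_mul_eq_mul_left hm0 ?_
    rw [← mul_assoc, ← key, mul_assoc, card_pick (hm 0 i)]
    ring
  | succ l ih =>
    have hlD : ((Fin.ofNat (D + 1) (l + 1) : Fin (D + 1)) : ℕ) = l + 1 := by
      simp; omega
    have key := sum_sum_update
      (fun η => if treeSample parent part w N D η (l + 1) i = x then 1 else 0)
      (i, Fin.ofNat (D + 1) (l + 1))
    set p : Fin k → ℕ :=
      fun c => if parent c = i then ∑ x, treeWeight parent part w l c x else 0 with hp
    have hpm : ∑ c, p c ≤ N := by
      rw [hp, ← sum_treeWeight_succ]; exact hm _ _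
    -- Redrawing the seed of `i` at level `l + 1` changes the chosen child but none of the
    -- children's samples.
    have h2 : ∀ η u, treeSample parent part w N D
        (Function.update η (i, Fin.ofNat (D + 1) (l + 1)) u) (l + 1) i
        = if parent (pick N p u) = i then treeSample parent part w N D η l (pick N p u)
          else Classical.arbitrary X := fun η u => by
      simp only [treeSample, Function.update_self]
      rw [treeSample_update _ _ _ _ _ _ _ _ _ _ (by omega)]
    have h3 : ∀ η, (∑ u, if treeSample parent part w N D
        (Function.update η (i, Fin.ofNat (D + 1) (l + 1)) u) (l + 1) i = x then 1 else 0)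
          * ∑ c, p c
        = N.factorial * ∑ c, p c * if treeSample parent part w N D η l c = x then 1 else 0 := fun η => by
      have h4 : ∀ u, (if treeSample parent part w N D
          (Function.update η (i, Fin.ofNat (D + 1) (l + 1)) u) (l + 1) i = x then 1 else 0)
          = ∑ c, if pick N p u = c then (if (if parent c = i then
              treeSample parent part w N D η l c else Classical.arbitrary X) = x then 1 else 0)
              else 0 := fun u => by
        rw [h2, Finset.sum_ite_eq]; simp
      simp only [h4]
      rw [Finset.sum_comm, Finset.sum_mul, Finset.mul_sum]
      refine Finset.sum_congr rfl fun c _ => ?_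
      have h5 := card_pick hpm c
      rw [← mul_assoc, ← h5]
      by_cases hc : parent c = i
      · simp only [hc, if_true]
        by_cases hx : treeSample parent part w N D η l c = x <;> simp [hx]
      -- A non-child has weight zero, so it is never picked unless the total weight of the block is
      -- zero; both sides vanish either way.
      · have hp0 : p c = 0 := by simp [hp, hc]
        rw [hp0, mul_zero] at h5
        rw [h5, zero_mul, mul_eq_zero]
        rcases mul_eq_zero.1 h5 with h6 | h6
        · left
          refine Finset.sum_eq_zero fun u _ => ?_
          have := (Finset.sum_eq_zero_iff.1 h6) u (Finset.mem_univ u)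
          rw [if_neg]
          intro h7; simp [h7] at this
        · exact Or.inr h6
    refine Nat.eq_of_mul_eq_mul_left hm0 ?_
    rw [sum_treeWeight_succ, ← mul_assoc]
    rw [Fintype.card_fin] at key
    rw [← key, Finset.sum_mul]
    simp only [← hp] at h3 ⊢
    simp only [h3]
    rw [← Finset.mul_sum, Finset.sum_comm]
    congr 1
    rw [treeWeight, Finset.mul_sum]
    refine Finset.sum_congr rfl fun c _ => ?_
    rw [← Finset.mul_sum]
    by_cases hc : parent c = i
    · simp only [hp, hc, if_true]
      rw [← ih (by omega) c]; ring
    · simp [hp, hc]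

end Tree
-- Clarkson's reweighting.
section Reweighting

variable {X : Type u} {R : Type v} (region : X → Set R) (f : Finset X → R) (M : ℕ)

open Classical in
/-- The number of the earlier samples whose optimum is violated by `x`. -/
noncomputable def violations (past : List (Finset X)) (x : X) : ℕ :=
  past.countP fun T => f T ∉ region x

/-- The weight of a constraint is multiplied by `M` whenever it is violated. -/
noncomputable def weight (past : List (Finset X)) (x : X) : ℕ := M ^ violations region f past x

open Classical in
lemma violations_cons (T : Finset X) (past : List (Finset X)) (x : X) :
    violations region f (T :: past) x
      = violations region f past x + if f T ∉ region x then 1 else 0 := by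
  simp [violations, List.countP_cons]

lemma weight_pos {M : ℕ} (hM : 0 < M) (past : List (Finset X)) (x : X) :
    0 < weight region f M past x := pow_pos hM _

lemma weight_le {M : ℕ} (hM : 0 < M) (past : List (Finset X)) (x : X) {t : ℕ}
    (ht : past.length ≤ t) : weight region f M past x ≤ M ^ t :=
  Nat.pow_le_pow_right hM (List.countP_le_length.trans ht)

open Classical in
-- The true increment of a violated weight is `M - 1` times the weight; using `M` avoids subtraction
-- and costs nothing later.
lemma weight_cons_le (T : Finset X) (past : List (Finset X)) (x : X) :
    weight region f M (T :: past) x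
      ≤ weight region f M past x + M * if f T ∉ region x then weight region f M past x else 0 := by
  rw [weight, violations_cons]
  by_cases hx : f T ∈ region x
  · simp [hx, weight]
  · simp [hx, weight, pow_succ, mul_comm]

section Samples

variable {Ω : Type*} {r : ℕ} (smp : (X → ℕ) → Ω → X)

open Classical in
/-- The samples of the first iterations, if the constraints are drawn by `smp`. -/
noncomputable def samples (ω : ℕ → Fin r → Ω) : ℕ → List (Finset X)
  | 0 => []
  | t + 1 =>
      (Finset.univ.image fun q => smp (weight region f M (samples ω t)) (ω t q)) :: samples ω t

lemma length_samples (ω : ℕ → Fin r → Ω) (t : ℕ) :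
    (samples region f M smp ω t).length = t := by
  induction t with
  | zero => rfl
  | succ t ih => simp [samples, ih]

lemma samples_congr {ω ω' : ℕ → Fin r → Ω} (t : ℕ) (h : ∀ s < t, ω s = ω' s) :
    samples region f M smp ω t = samples region f M smp ω' t := by
  induction t with
  | zero => rfl
  | succ t ih =>
    rw [samples, samples, ih fun s hs => h s (by omega), h t (by omega)]

/-- The sampler draws the members of `S` with probabilities proportional to the weights, for all
weights up to `C`. -/
def IsExactSampler [Fintype Ω] (S : Finset X) (C : ℕ) : Prop :=
  ∀ w : X → ℕ, (∀ x, 0 < w x) → (∀ x, w x ≤ C) → (∀ η, smp w η ∈ S) ∧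
    ∀ x ∈ S, Nat.card {η // smp w η = x} * ∑ y ∈ S, w y = Fintype.card Ω * w x

variable {region f M smp} {S : Finset X} [Fintype Ω] {T : ℕ}

lemma samples_subset (hM : 0 < M) (hs : IsExactSampler smp S (M ^ T)) (ω : ℕ → Fin r → Ω)
    {t : ℕ} (ht : t ≤ T) {A : Finset X} (hA : A ∈ samples region f M smp ω t) : A ⊆ S := by
  classical
  induction t with
  | zero => simp [samples] at hA
  | succ t ih =>
    rw [samples, List.mem_cons] at hA
    rcases hA with rfl | hA
    · intro x hx
      obtain ⟨q, -, rfl⟩ := Finset.mem_image.1 hx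
      exact (hs _ (weight_pos region f hM _)
        (fun x => weight_le region f hM _ x (by rw [length_samples]; omega))).1 _
    · exact ih (by omega) hA

end Samples

variable [LinearOrder R] {region f M} {S : Finset X}

/-- As long as no sample has the right optimum, every sample is violated by a member of a basis, so
that some constraint has been violated often. -/
lemma pow_le_sum_weight (h : LPType.HasRegions region f S) {ν τ : ℕ}
    (hν : LPType.combDim f S ≤ ν) (hν1 : 1 ≤ ν) (hτ : 1 ≤ τ) (hM : 0 < M)
    {past : List (Finset X)} (hS : ∀ T ∈ past, T ⊆ S) (hf : ∀ T ∈ past, f T ≠ f S)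
    (hlen : past.length = ν * τ) : M ^ τ ≤ ∑ x ∈ S, weight region f M past x := by
  classical
  obtain ⟨B, hB, hcard⟩ := h.exists_isBasis (subset_refl S)
  -- If `f T` satisfied all of `B`, it would be at least `f B = f S`, hence equal to it.
  have hviol : ∀ T ⊆ S, f T ≠ f S → ∃ x ∈ B, f T ∉ region x := fun T hT hTf => by
    by_contra! hcon
    exact hTf (le_antisymm (h.mono hT subset_rfl)
      (hB.2.1 ▸ h.le_of_forall_mem hB.1 hcon))
  have hsum : ∀ past : List (Finset X), (∀ T ∈ past, T ⊆ S) → (∀ T ∈ past, f T ≠ f S) →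
      past.length ≤ ∑ x ∈ B, violations region f past x := by
    intro past
    induction past with
    | nil => simp
    | cons T past ih =>
      intro hS hf
      simp only [List.mem_cons, forall_eq_or_imp] at hS hf
      simp only [violations_cons, Finset.sum_add_distrib, List.length_cons]
      refine Nat.add_le_add (ih hS.2 hf.2) ?_
      obtain ⟨x, hx, hTx⟩ := hviol T hS.1 hf.1
      calc 1 = if f T ∉ region x then 1 else 0 := by simp [hTx]
        _ ≤ _ := Finset.single_le_sum (f := fun x => if f T ∉ region x then 1 else 0)
          (fun _ _ => Nat.zero_le _) hx
  -- Pigeonhole: `ν * τ` violations fall on at most `ν` members of `B`.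
  have hx : ∃ x ∈ B, τ ≤ violations region f past x := by
    by_contra! hcon
    have h1 := hsum past hS hf
    have h2 : ∑ x ∈ B, violations region f past x ≤ B.card * (τ - 1) :=
      Finset.sum_le_card_nsmul _ _ _ fun x hx => Nat.le_sub_one_of_lt (hcon x hx)
    have h3 : B.card * (τ - 1) ≤ ν * (τ - 1) := Nat.mul_le_mul_right _ (hcard.trans hν)
    have h4 : ν * (τ - 1) < ν * τ := Nat.mul_lt_mul_of_pos_left (by omega) hν1
    omega
  obtain ⟨x, hxB, hx⟩ := hx
  calc M ^ τ ≤ weight region f M past x := Nat.pow_le_pow_right hM hx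
    _ ≤ _ := Finset.single_le_sum (f := fun x => weight region f M past x)
      (fun _ _ => Nat.zero_le _) (hB.1 hxB)

open Classical in
/-- One iteration increases the total weight by a factor of at most `1 + 1 / ν` on average. -/
lemma sum_weight_cons_le (h : LPType.HasRegions region f S) {ν r : ℕ}
    (hν : LPType.combDim f S ≤ ν) (hr : ν ^ 2 * M ≤ r + 1) {Ω : Type*} [Fintype Ω] [Nonempty Ω]
    (G : Ω → X) (hG : ∀ η, G η ∈ S) (past : List (Finset X))
    (hw : ∀ x ∈ S, (∑ η, if G η = x then 1 else 0) * ∑ y ∈ S, weight region f M past y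
      = Fintype.card Ω * weight region f M past x) :
    ν * ∑ ω : Fin r → Ω,
        ∑ x ∈ S, weight region f M ((Finset.univ.image fun q => G (ω q)) :: past) x
      ≤ (ν + 1) * (∑ x ∈ S, weight region f M past x) * Fintype.card (Fin r → Ω) := by
  set W := ∑ x ∈ S, weight region f M past x with hW
  have h1 := sampling_lemma h hν G hG (weight region f M past) W hw r
  set V : (Fin r → Ω) → ℕ := fun ω =>
    ∑ x ∈ S with f (Finset.univ.image fun q => G (ω q)) ∉ region x, weight region f M past x
  have h2 : ∀ ω : Fin r → Ω,
      ∑ x ∈ S, weight region f M ((Finset.univ.image fun q => G (ω q)) :: past) x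
        ≤ W + M * V ω := fun ω => by
    refine (Finset.sum_le_sum fun x _ => weight_cons_le region f M _ past x).trans (le_of_eq ?_)
    simp only [V, Finset.sum_add_distrib, ← Finset.mul_sum, Finset.sum_filter, hW]
  -- The sample size is chosen for this step: the added weight is on average at most `Mν / (r + 1)`
  -- of the total, which `hr` makes at most `1 / ν`.
  have h3 : ν * (M * ∑ ω, V ω) ≤ W * Fintype.card (Fin r → Ω) := by
    refine Nat.le_of_mul_le_mul_left (c := r + 1) ?_ r.succ_pos
    calc (r + 1) * (ν * (M * ∑ ω, V ω)) = ν * M * ((r + 1) * ∑ ω, V ω) := by ring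
      _ ≤ ν * M * (ν * W * Fintype.card (Fin r → Ω)) := Nat.mul_le_mul_left _ h1
      _ = ν ^ 2 * M * (W * Fintype.card (Fin r → Ω)) := by ring
      _ ≤ _ := Nat.mul_le_mul_right _ hr
  calc ν * ∑ ω : Fin r → Ω,
        ∑ x ∈ S, weight region f M ((Finset.univ.image fun q => G (ω q)) :: past) x
      ≤ ν * ∑ ω : Fin r → Ω, (W + M * V ω) :=
        Nat.mul_le_mul_left _ (Finset.sum_le_sum fun ω _ => h2 ω)
    _ = ν * W * Fintype.card (Fin r → Ω) + ν * (M * ∑ ω, V ω) := by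
        rw [Finset.sum_add_distrib, ← Finset.mul_sum, Finset.sum_const, Finset.card_univ,
          smul_eq_mul]; ring
    _ ≤ ν * W * Fintype.card (Fin r → Ω) + W * Fintype.card (Fin r → Ω) :=
        Nat.add_le_add_left h3 _
    _ = _ := by ring

section Expectation

variable {Ω : Type*} [Fintype Ω] [Nonempty Ω] {r T : ℕ} {smp : (X → ℕ) → Ω → X}

/-- The expected total weight after `t` iterations. -/
lemma sum_sum_weight_le (h : LPType.HasRegions region f S) {ν : ℕ}
    (hν : LPType.combDim f S ≤ ν) (hM : 0 < M) (hr : ν ^ 2 * M ≤ r + 1)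
    (hs : IsExactSampler smp S (M ^ T)) (t : ℕ) (ht : t ≤ T) :
    ν ^ t * ∑ ω : Fin (T + 1) → Fin r → Ω,
        ∑ x ∈ S, weight region f M (samples region f M smp (fun s => ω (Fin.ofNat (T + 1) s)) t) x
      ≤ (ν + 1) ^ t * (S.card * Fintype.card (Fin (T + 1) → Fin r → Ω)) := by
  classical
  induction t with
  | zero => simp [samples, weight, violations, mul_comm]
  | succ t ih =>
    set c := Fintype.card (Fin r → Ω) with hc
    have hcpos : 0 < c := Fintype.card_pos
    let P : (Fin (T + 1) → Fin r → Ω) → ℕ → List (Finset X) := fun ω t =>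
      samples region f M smp (fun s => ω (Fin.ofNat (T + 1) s)) t
    -- Averaging first over fresh seeds for iteration `t` acts as conditioning on the past, because
    -- the earlier samples do not read them.
    have key := sum_sum_update (fun ω => ∑ x ∈ S, weight region f M (P ω (t + 1)) x)
      (Fin.ofNat (T + 1) t)
    have hupd : ∀ ω a, P (Function.update ω (Fin.ofNat (T + 1) t) a) (t + 1)
        = (Finset.univ.image fun q => smp (weight region f M (P ω t)) (a q)) :: P ω t := by
      intro ω a
      have h1 : P (Function.update ω (Fin.ofNat (T + 1) t) a) t = P ω t := by
        refine samples_congr region f M smp t fun s hs' => Function.update_of_ne ?_ _ _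
        intro he
        have := congrArg Fin.val he
        simp only [Fin.val_ofNat] at this
        rw [Nat.mod_eq_of_lt (by omega), Nat.mod_eq_of_lt (by omega)] at this
        omega
      simp only [P, samples] at h1 ⊢
      rw [h1, Function.update_self]
    have hstep : ∀ ω, ν * ∑ a : Fin r → Ω, ∑ x ∈ S, weight region f M
        (P (Function.update ω (Fin.ofNat (T + 1) t) a) (t + 1)) x
        ≤ (ν + 1) * (∑ x ∈ S, weight region f M (P ω t) x) * c := fun ω => by
      simp only [hupd]
      obtain ⟨h1, h2⟩ := hs _ (weight_pos region f hM (P ω t))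
        (fun x => weight_le region f hM (P ω t) x (by simp only [P, length_samples]; omega))
      refine sum_weight_cons_le h hν hr _ h1 _ fun x hx => ?_
      rw [← h2 x hx, Nat.card_eq_fintype_card, Fintype.card_subtype, Finset.sum_boole,
        Nat.cast_id]
    refine Nat.le_of_mul_le_mul_left ?_ hcpos
    calc c * (ν ^ (t + 1) * ∑ ω, ∑ x ∈ S, weight region f M (P ω (t + 1)) x)
        = ν ^ t * ∑ ω, ν * ∑ a : Fin r → Ω, ∑ x ∈ S, weight region f M
            (P (Function.update ω (Fin.ofNat (T + 1) t) a) (t + 1)) x := by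
          rw [← Finset.mul_sum, key]; ring
      _ ≤ ν ^ t * ∑ ω, (ν + 1) * (∑ x ∈ S, weight region f M (P ω t) x) * c :=
          Nat.mul_le_mul_left _ (Finset.sum_le_sum fun ω _ => hstep ω)
      _ = c * (ν + 1) * (ν ^ t * ∑ ω, ∑ x ∈ S, weight region f M (P ω t) x) := by
          rw [← Finset.sum_mul, ← Finset.mul_sum]; ring
      _ ≤ c * (ν + 1) * _ := Nat.mul_le_mul_left _ (ih (by omega))
      _ = _ := by ring

open Classical in
/-- Few seeds are such that no sample has the right optimum. -/
lemma card_failures_le (h : LPType.HasRegions region f S) {ν τ : ℕ}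
    (hν : LPType.combDim f S ≤ ν) (hν1 : 1 ≤ ν) (hτ : 1 ≤ τ) (hM : 0 < M)
    (hr : ν ^ 2 * M ≤ r + 1) (hs : IsExactSampler smp S (M ^ (ν * τ))) :
    ν ^ (ν * τ) * (M ^ τ * (Finset.univ.filter fun ω : Fin (ν * τ + 1) → Fin r → Ω =>
      ∀ A ∈ samples region f M smp (fun s => ω (Fin.ofNat (ν * τ + 1) s)) (ν * τ),
        f A ≠ f S).card)
      ≤ (ν + 1) ^ (ν * τ) * (S.card * Fintype.card (Fin (ν * τ + 1) → Fin r → Ω)) := by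
  refine le_trans (Nat.mul_le_mul_left _ ?_)
    (sum_sum_weight_le h hν hM hr hs (ν * τ) le_rfl)
  -- Markov's inequality: each failing seed contributes at least `M ^ τ` to the sum of total
  -- weights.
  rw [mul_comm, ← smul_eq_mul, ← Finset.sum_const]
  refine (Finset.sum_le_sum fun ω hω => ?_).trans
    (Finset.sum_le_sum_of_subset (Finset.filter_subset _ _))
  exact pow_le_sum_weight h hν hν1 hτ hM (fun A hA => samples_subset hM hs _ le_rfl hA)
    (Finset.mem_filter.1 hω).2 (length_samples _ _ _ _ _ _)

end Expectation

end Reweighting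

/-! ### The tree as an exact sampler. -/

section TreeSampler

variable {X : Type u} [Fintype X] [Nonempty X] {k : ℕ} [NeZero k] (parent : Fin k → Fin k)
  (part : Fin k → Finset X) {N D : ℕ}

/-- The block of the root at level `D` is all of `S`. Constraints outside `S` have weight zero
there, while the total is positive, so they are never drawn. -/
lemma isExactSampler_treeSample {S : Finset X} (hS : S.Nonempty) (hpart : IsInputPartition part S)
    {i : Fin k} (hroot : ∀ j, parent^[D] j = i) {C : ℕ} (hN : S.card * C ≤ N) :
    IsExactSampler (fun w η => treeSample parent part w N D η D i) S C := by
  classical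
  intro w hpos hC
  have hle : ∑ x ∈ S, w x ≤ N := (Finset.sum_le_card_nsmul S w C fun x _ => hC x).trans hN
  have hcard : ∀ x, Nat.card {η // treeSample parent part w N D η D i = x} * ∑ y ∈ S, w y
      = Fintype.card (Fin k × Fin (D + 1) → Fin N.factorial)
        * Set.indicator (S : Set X) w x := fun x => by
    rw [← treeWeight_root parent part w hpart hroot,
      ← sum_treeWeight_root parent part w hpart hroot, ← card_treeSample parent part w N D
        (fun l i => (sum_treeWeight_le parent part w hpart l i).trans hle) D le_rfl]
    rw [Nat.card_eq_fintype_card, Fintype.card_subtype, Finset.sum_boole, Nat.cast_id]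
  refine ⟨fun η => ?_, fun x hx => ?_⟩
  · by_contra hη
    have h1 := hcard (treeSample parent part w N D η D i)
    rw [Set.indicator_of_notMem (by simpa using hη), mul_zero, mul_eq_zero] at h1
    rcases h1 with h1 | h1
    · rw [Nat.card_eq_zero] at h1
      rcases h1 with h1 | h1
      · exact h1.elim ⟨η, rfl⟩
      · exact h1.not_finite inferInstance
    · exact absurd h1 (Finset.sum_pos (fun x _ => hpos x) hS).ne'
  · rw [hcard, Set.indicator_of_mem (by simpa using hx)]

end TreeSampler
-- Messages and their binary codes.
section Messages

variable {X : Type u} [Fintype X] [Nonempty X] {k r : ℕ} [NeZero k] (N : ℕ)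

open Classical in
/-- The total weight of a part of the input, together with weighted samples from it. -/
noncomputable def leafMsg (p : Finset X) (w : X → ℕ) (u : Fin r → Fin N.factorial) :
    ℕ × (Fin r → X) :=
  (∑ x, if x ∈ p then w x else 0, fun q => pick N (fun x => if x ∈ p then w x else 0) (u q))

/-- The total weight of several parts of the input, together with weighted samples from their
union. -/
noncomputable def mergeMsg (msgs : Fin k → ℕ × (Fin r → X)) (u : Fin r → Fin N.factorial) :
    ℕ × (Fin r → X) :=
  (∑ c, (msgs c).1, fun q => (msgs (pick N (fun c => (msgs c).1) (u q))).2 q)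

variable {N} {D : ℕ} (parent : Fin k → Fin k) (part : Fin k → Finset X) (w : X → ℕ)

/-- What node `i` knows about its block at level `l` of the aggregation tree. -/
noncomputable def treeMsg (η : Fin r → Fin k × Fin (D + 1) → Fin N.factorial) (l : ℕ)
    (i : Fin k) : ℕ × (Fin r → X) :=
  (∑ x, treeWeight parent part w l i x, fun q => treeSample parent part w N D (η q) l i)

/-- The messages that node `i` uses in an aggregation step: those of its children. -/
noncomputable def fromChildren (i : Fin k) (msgs : Fin k → ℕ × (Fin r → X)) :
    Fin k → ℕ × (Fin r → X) :=
  fun c => if parent c = i then msgs c else (0, fun _ => Classical.arbitrary X)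

/-- A node needs only its children's messages. The default sample of `fromChildren` agrees with that
of `treeSample`, so equality holds even when all weights vanish and a non-child is picked. -/
lemma treeMsg_succ (η : Fin r → Fin k × Fin (D + 1) → Fin N.factorial) (l : ℕ) (i : Fin k) :
    treeMsg parent part w η (l + 1) i
      = mergeMsg N (fromChildren parent i (treeMsg parent part w η l))
          fun q => η q (i, Fin.ofNat (D + 1) (l + 1)) := by
  have h1 : ∀ c, (fromChildren parent i (treeMsg parent part w η l) c).1
      = if parent c = i then ∑ x, treeWeight parent part w l c x else 0 := fun c => by
    unfold fromChildren; split_ifs <;> rfl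
  unfold mergeMsg
  simp only [h1]
  refine Prod.ext (sum_treeWeight_succ parent part w l i) (funext fun q => ?_)
  simp only [treeMsg, treeSample, fromChildren]
  split_ifs <;> rfl

lemma exists_code {α : Type*} [Fintype α] [Nonempty α] {L : ℕ} (h : Fintype.card α ≤ 2 ^ L) :
    ∃ (enc : α → List Bool) (dec : List Bool → α),
      (∀ a, (enc a).length = L) ∧ ∀ a, dec (enc a) = a := by
  obtain ⟨e⟩ := Function.Embedding.nonempty_of_card_le (α := α) (β := Fin L → Bool)
    (by simpa using h)
  exact ⟨fun a => List.ofFn (e a), Function.invFun fun a => List.ofFn (e a), by simp,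
    Function.leftInverse_invFun (List.ofFn_injective.comp e.injective)⟩

lemma exists_msg_code (N r L : ℕ) (h : (N + 1) * Fintype.card X ^ r ≤ 2 ^ L) :
    ∃ (enc : ℕ × (Fin r → X) → List Bool) (dec : List Bool → ℕ × (Fin r → X)),
      (∀ m, (enc m).length = L) ∧ ∀ m, m.1 ≤ N → dec (enc m) = m := by
  classical
  obtain ⟨enc, dec, h1, h2⟩ := exists_code (α := Fin (N + 1) × (Fin r → X)) (L := L)
    (by simpa using h)
  refine ⟨fun m => enc (Fin.ofNat (N + 1) m.1, m.2),
    fun b => ((dec b).1, (dec b).2), fun m => h1 _, fun m hm => ?_⟩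
  simp only [h2, Fin.val_ofNat]
  rw [Nat.mod_eq_of_lt (by omega)]

end Messages

/-! ### The `d`-ary tree on the machines. -/

section Tree

variable {k : ℕ} (d : ℕ)

/-- The parent of a machine in the `d`-ary aggregation tree with root `0`. -/
def parent (i : Fin k) : Fin k := ⟨i / d, (Nat.div_le_self _ _).trans_lt i.2⟩

lemma val_iterate_parent (l : ℕ) (i : Fin k) : ((parent d)^[l] i : ℕ) = i / d ^ l := by
  induction l with
  | zero => simp
  | succ l ih =>
    rw [Function.iterate_succ_apply', pow_succ, ← Nat.div_div_eq_div_mul, ← ih]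
    rfl

lemma iterate_parent_eq_zero [NeZero k] {D : ℕ} (hD : k ≤ d ^ D) (i : Fin k) :
    (parent d)^[D] i = 0 :=
  Fin.ext <| by
    rw [val_iterate_parent, Nat.div_eq_of_lt (i.2.trans_le hD), Fin.val_zero]

/-- Siblings share their quotient by `d`, so their remainders are distinct. -/
lemma card_children_le (hd : 0 < d) (i : Fin k) :
    (Finset.univ.filter fun j => parent d j = i).card ≤ d := by
  conv_rhs => rw [← Finset.card_range d]
  refine Finset.card_le_card_of_injOn (fun j => (j : ℕ) % d)
    (fun j _ => by simpa using Nat.mod_lt _ hd) fun a ha b hb hab => Fin.ext ?_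
  have h1 := congrArg Fin.val ((Finset.mem_filter.1 ha).2.trans (Finset.mem_filter.1 hb).2.symm)
  simp only [parent] at h1 hab
  rw [← Nat.div_add_mod (a : ℕ) d, ← Nat.div_add_mod (b : ℕ) d, h1, hab]

end Tree

/-! ### The intended run of the protocol. -/

section Trace

variable {X : Type u} {R : Type v} [Fintype X] [Nonempty X] {k r N : ℕ} [NeZero k]
  (region : X → Set R) (f : Finset X → R) (M d D T : ℕ) (part : Fin k → Finset X)
  (seed : Fin k → Fin (T + 1) → Fin r → Fin (D + 1) → Fin N.factorial)

/-- The samples of the first `t` iterations of the protocol. -/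
noncomputable def protocolSamples : ℕ → List (Finset X) :=
  samples region f M (fun w η => treeSample (parent d) part w N D η D 0)
    fun s q a => seed a.1 (Fin.ofNat (T + 1) s) q a.2

/-- The message of machine `i` at level `l` of iteration `τ`. -/
noncomputable def levelMsg (τ l : ℕ) (i : Fin k) : ℕ × (Fin r → X) :=
  treeMsg (parent d) part (weight region f M (protocolSamples region f M d D T part seed τ))
    (fun q a => seed a.1 (Fin.ofNat (T + 1) τ) q a.2) l i

/-- Keeps every transmitted weight in the range where decoding inverts encoding. -/
lemma levelMsg_fst_le {S : Finset X} (hM : 0 < M) (hpart : IsInputPartition part S) (hN : S.card * M ^ T ≤ N)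
    {τ : ℕ} (hτ : τ ≤ T) (l : ℕ) (i : Fin k) :
    (levelMsg region f M d D T part seed τ l i).1 ≤ N := by
  refine (sum_treeWeight_le (parent d) part _ hpart l i).trans (le_trans ?_ hN)
  exact Finset.sum_le_card_nsmul _ _ _ fun x _ => weight_le region f hM _ x
    (by rw [protocolSamples, length_samples]; exact hτ)

end Trace

/-! ### The protocol, its load and its correctness. -/

section Protocol

variable {X : Type u} {R : Type v} [LinearOrder R] [Fintype X] [Nonempty X] {k r N : ℕ} [NeZero k]
  (region : X → Set R) (f : Finset X → R) (M d D T : ℕ)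
  (enc : ℕ × (Fin r → X) → List Bool) (dec : List Bool → ℕ × (Fin r → X))

open Classical in
/-- What machine `i` knows after the rounds with the given inboxes: the samples of the finished
iterations and its current message.  An iteration consists of `D` rounds in which messages are
aggregated towards the root, and `D` rounds in which the sample of the root is distributed. -/
noncomputable def nodeState (i : Fin k) (p : Finset X)
    (seed : Fin (T + 1) → Fin r → Fin (D + 1) → Fin N.factorial) :
    List (Fin k → List Bool) → List (Finset X) × (ℕ × (Fin r → X))
  | [] => ([], leafMsg N p (weight region f M []) fun q => seed 0 q 0)
  | inbox :: h =>
      let s := nodeState i p seed h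
      let t := h.length / (2 * D)
      let ph := h.length % (2 * D)
      if ph < D then
        (s.1, mergeMsg N (fromChildren (parent d) i fun c => dec (inbox c))
          fun q => seed (Fin.ofNat (T + 1) t) q (Fin.ofNat (D + 1) (ph + 1)))
      else if ph + 1 < 2 * D then (s.1, dec (inbox (parent d i)))
      else
        let past := Finset.univ.image (dec (inbox (parent d i))).2 :: s.1
        (past, leafMsg N p (weight region f M past) fun q => seed (Fin.ofNat (T + 1) (t + 1)) q 0)

/-- Clarkson's reweighting algorithm with `T` iterations, on a `d`-ary tree of depth `D`. -/
noncomputable def protocol (k N : ℕ) [NeZero k] : MPCProtocol k X R where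
  rounds := T * (2 * D)
  Seed := Fin (T + 1) → Fin r → Fin (D + 1) → Fin N.factorial
  finite_seed := inferInstance
  nonempty_seed := ⟨fun _ _ _ => ⟨0, N.factorial_pos⟩⟩
  send i p seed h j :=
    if (if h.length % (2 * D) < D then j = parent d i else parent d j = i) then
      enc (nodeState region f M d D T dec i p seed h).2 else []
  output i p seed h := ((nodeState region f M d D T dec i p seed h).1.map f).foldr max (f ∅)

/-- The history's length is the clock from which a machine reads iteration and phase. -/
lemma length_history (part : Fin k → Finset X)
    (seed : Fin k → (protocol region f M d D T enc dec k N).Seed) (t : ℕ) (i : Fin k) :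
    ((protocol region f M d D T enc dec k N).history part seed t i).length = t := by
  induction t generalizing i with
  | zero => simp [MPCProtocol.history]
  | succ t ih => rw [MPCProtocol.history, List.length_cons, ih]

/-- On the way up a machine sends to one parent and receives from at most `d` children; on the way
down the roles are reversed. -/
lemma protocol_load {L : ℕ} (hL : ∀ m, (enc m).length = L) (hd : 0 < d)
    (part : Fin k → Finset X)
    (seed : Fin k → (protocol region f M d D T enc dec k N).Seed) :
    (protocol region f M d D T enc dec k N).LoadAtMost part seed ((d * L : ℕ) : ℝ) := by
  intro t _ i
  have hbound : ∀ p : Fin k → Prop, [DecidablePred p] →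
      (Finset.univ.filter p).card ≤ d → ∑ j, (if p j then L else 0) ≤ d * L := by
    intro p _ hp
    rw [← Finset.sum_filter, Finset.sum_const, smul_eq_mul]
    exact Nat.mul_le_mul_right _ hp
  have hone : ∀ a : Fin k, (Finset.univ.filter fun j => j = a).card ≤ d := fun a => by
    simpa [Finset.filter_eq'] using Nat.succ_le_of_lt hd
  have hone' : ∀ a : Fin k, (Finset.univ.filter fun j => a = j).card ≤ d := fun a => by
    simpa [Finset.filter_eq] using Nat.succ_le_of_lt hd
  have hlen := length_history region f M d D T enc dec part seed t
  have hmsg : ∀ i j, ((protocol region f M d D T enc dec k N).message part seed t i j).length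
      = if (if t % (2 * D) < D then j = parent d i else parent d j = i) then L else 0 := by
    intro i j
    unfold MPCProtocol.message
    simp only [protocol] at hlen ⊢
    simp only [hlen]
    split_ifs <;> simp [hL]
  simp only [hmsg, Nat.cast_le]
  by_cases ht : t % (2 * D) < D
  · simp only [ht, if_true]
    refine ⟨hbound _ (hone _), hbound (fun j => i = parent d j) ?_⟩
    simpa only [eq_comm] using card_children_le d hd i
  · simp only [ht, if_false]
    exact ⟨hbound _ (card_children_le d hd i), hbound _ (hone' _)⟩

variable (part : Fin k → Finset X)
  (seed : Fin k → Fin (T + 1) → Fin r → Fin (D + 1) → Fin N.factorial)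

/-- The state of machine `i` after `t` rounds. -/
noncomputable def stateAt (t : ℕ) (i : Fin k) : List (Finset X) × (ℕ × (Fin r → X)) :=
  nodeState region f M d D T dec i (part i) (seed i)
    ((protocol region f M d D T enc dec k N).history part seed t i)

lemma history_succ (t : ℕ) (i : Fin k) :
    (protocol region f M d D T enc dec k N).history part seed (t + 1) i
      = (fun j => (protocol region f M d D T enc dec k N).send j (part j) (seed j)
          ((protocol region f M d D T enc dec k N).history part seed t j) i)
        :: (protocol region f M d D T enc dec k N).history part seed t i := rfl

lemma stateAt_succ_of_lt {t : ℕ} (i : Fin k) (ht : t % (2 * D) < D) :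
    stateAt region f M d D T enc dec part seed (t + 1) i
      = ((stateAt region f M d D T enc dec part seed t i).1,
        mergeMsg N (fromChildren (parent d) i fun c =>
          dec (enc (stateAt region f M d D T enc dec part seed t c).2))
          fun q => seed i (Fin.ofNat (T + 1) (t / (2 * D))) q
            (Fin.ofNat (D + 1) (t % (2 * D) + 1))) := by
  have hlen := length_history region f M d D T enc dec part seed t
  have h1 : fromChildren (X := X) (r := r) (parent d) i (fun c => dec
      ((protocol region f M d D T enc dec k N).send c (part c) (seed c)
        ((protocol region f M d D T enc dec k N).history part seed t c) i))
      = fromChildren (parent d) i fun c =>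
          dec (enc (stateAt region f M d D T enc dec part seed t c).2) := by
    funext c
    unfold fromChildren
    split_ifs with hc
    · simp only [protocol, stateAt] at hlen ⊢
      simp only [hlen, ht, if_true, hc]
    · rfl
  conv_lhs => rw [stateAt, history_succ, nodeState]
  simp only [hlen, ht, if_true, h1]
  rfl

lemma inbox_parent {t : ℕ} (i : Fin k) (ht : ¬ t % (2 * D) < D) :
    (protocol region f M d D T enc dec k N).send (parent d i) (part (parent d i))
        (seed (parent d i))
        ((protocol region f M d D T enc dec k N).history part seed t (parent d i)) i
      = enc (stateAt region f M d D T enc dec part seed t (parent d i)).2 := by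
  have hlen := length_history region f M d D T enc dec part seed t
  simp only [protocol, stateAt] at hlen ⊢
  simp only [hlen, ht, if_false, if_true]

lemma stateAt_succ_of_le {t : ℕ} (i : Fin k) (ht : ¬ t % (2 * D) < D)
    (ht' : t % (2 * D) + 1 < 2 * D) :
    stateAt region f M d D T enc dec part seed (t + 1) i
      = ((stateAt region f M d D T enc dec part seed t i).1,
        dec (enc (stateAt region f M d D T enc dec part seed t (parent d i)).2)) := by
  have hlen := length_history region f M d D T enc dec part seed t
  conv_lhs => rw [stateAt, history_succ, nodeState]
  simp only [hlen, ht, ht', if_true, if_false, inbox_parent region f M d D T enc dec part seed i ht]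
  rfl

open Classical in
lemma stateAt_succ_of_last {t : ℕ} (i : Fin k) (ht : ¬ t % (2 * D) < D)
    (ht' : ¬ t % (2 * D) + 1 < 2 * D) :
    stateAt region f M d D T enc dec part seed (t + 1) i
      = let past := Finset.univ.image
          (dec (enc (stateAt region f M d D T enc dec part seed t (parent d i)).2)).2
          :: (stateAt region f M d D T enc dec part seed t i).1
        (past, leafMsg N (part i) (weight region f M past)
          fun q => seed i (Fin.ofNat (T + 1) (t / (2 * D) + 1)) q 0) := by
  have hlen := length_history region f M d D T enc dec part seed t
  conv_lhs => rw [stateAt, history_succ, nodeState]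
  simp only [hlen, ht, ht', if_false, inbox_parent region f M d D T enc dec part seed i ht]
  rfl

variable {S : Finset X}

/-- The protocol keeps track of the samples. -/
lemma stateAt_iteration (hM : 0 < M) (hD : 0 < D) (hk : k ≤ d ^ D)
    (hpart : IsInputPartition part S) (hN : S.card * M ^ T ≤ N)
    (hdec : ∀ m, m.1 ≤ N → dec (enc m) = m) (τ : ℕ) (hτ : τ ≤ T) (i : Fin k) :
    stateAt region f M d D T enc dec part seed (2 * D * τ) i
      = (protocolSamples region f M d D T part seed τ,
        levelMsg region f M d D T part seed τ 0 i) := by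
  induction τ generalizing i with
  | zero =>
    rfl
  | succ τ ih =>
    have hmod : ∀ p, p < 2 * D → (2 * D * τ + p) % (2 * D) = p := fun p hp => by
      rw [Nat.mul_add_mod, Nat.mod_eq_of_lt hp]
    have hdiv : ∀ p, p < 2 * D → (2 * D * τ + p) / (2 * D) = τ := fun p hp => by
      rw [Nat.mul_add_div (by omega), Nat.div_eq_of_lt hp, add_zero]
    have hcode : ∀ l c, dec (enc (levelMsg region f M d D T part seed τ l c))
        = levelMsg region f M d D T part seed τ l c := fun l c =>
      hdec _ (levelMsg_fst_le region f M d D T part seed hM hpart hN (by omega) l c)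
    have hup : ∀ p ≤ D, ∀ i, stateAt region f M d D T enc dec part seed (2 * D * τ + p) i
        = (protocolSamples region f M d D T part seed τ,
          levelMsg region f M d D T part seed τ p i) := by
      intro p
      induction p with
      | zero => intro _ i; exact ih (by omega) i
      | succ p ihp =>
        intro hp i
        rw [← add_assoc, stateAt_succ_of_lt _ _ _ _ _ _ _ _ _ _ i
          (by rw [hmod p (by omega)]; omega), hmod p (by omega), hdiv p (by omega)]
        simp only [ihp (by omega), hcode]
        rw [levelMsg, treeMsg_succ]
        rfl
    -- Every machine forwards what it holds, at first only its own block's message. After `p` hops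
    -- machine `i` holds the message of its `p`-th ancestor, and `D` hops always reach the root,
    -- which is its own parent.
    have hdown : ∀ p < D, ∀ i, stateAt region f M d D T enc dec part seed (2 * D * τ + D + p) i
        = (protocolSamples region f M d D T part seed τ,
          levelMsg region f M d D T part seed τ D ((parent d)^[p] i)) := by
      intro p
      induction p with
      | zero => intro _ i; exact hup D le_rfl i
      | succ p ihp =>
        intro hp i
        rw [← add_assoc, stateAt_succ_of_le _ _ _ _ _ _ _ _ _ _ i
          (by rw [add_assoc, hmod _ (by omega)]; omega)
          (by rw [add_assoc, hmod _ (by omega)]; omega)]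
        simp only [ihp (by omega), hcode, Function.iterate_succ_apply]
    -- The `D`-th downward hop is the round that also closes the iteration, hence `D - 1` plain hops
    -- before it.
    have hlast : 2 * D * (τ + 1) = 2 * D * τ + D + (D - 1) + 1 := by
      rw [mul_add, mul_one]; omega
    have hiter : (parent d)^[D - 1] (parent d i) = 0 := by
      rw [← Function.iterate_succ_apply, Nat.succ_eq_add_one, Nat.sub_add_cancel hD]
      exact iterate_parent_eq_zero d hk i
    rw [hlast, stateAt_succ_of_last _ _ _ _ _ _ _ _ _ _ i
      (by rw [add_assoc, hmod _ (by omega)]; omega)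
      (by rw [add_assoc, hmod _ (by omega)]; omega), add_assoc, hdiv _ (by omega), ← add_assoc]
    simp only [hdown (D - 1) (by omega), hcode, hiter]
    rfl

lemma foldr_max_eq {l : List R} {a v : R} (ha : a ≤ v) (hl : ∀ b ∈ l, b ≤ v) (hv : v ∈ l) :
    l.foldr max a = v := by
  have hle : ∀ l : List R, (∀ b ∈ l, b ≤ v) → l.foldr max a ≤ v := by
    intro l
    induction l with
    | nil => simpa using ha
    | cons b l ih => intro h; simp at h; simpa [h.1] using ih h.2
  refine le_antisymm (hle l hl) ?_
  clear hl hle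
  induction l with
  | nil => simp at hv
  | cons b l ih =>
    rcases List.mem_cons.1 hv with rfl | hv
    · simp
    · exact (ih hv).trans (by simp)

/-- If one of the samples has the right optimum, then all machines output it. -/
lemma protocol_result (h : LPType.HasRegions region f S)
    (hM : 0 < M) (hD : 0 < D) (hk : k ≤ d ^ D)
    (hpart : IsInputPartition part S) (hN : S.card * M ^ T ≤ N)
    (hdec : ∀ m, m.1 ≤ N → dec (enc m) = m)
    (hS : ∀ A ∈ protocolSamples region f M d D T part seed T, A ⊆ S)
    (hf : ∃ A ∈ protocolSamples region f M d D T part seed T, f A = f S) (i : Fin k) :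
    (protocol region f M d D T enc dec k N).result part seed i = f S := by
  have h1 := stateAt_iteration region f M d D T enc dec part seed hM hD hk hpart hN hdec T le_rfl i
  have h2 : (protocol region f M d D T enc dec k N).result part seed i
      = ((stateAt region f M d D T enc dec part seed (2 * D * T) i).1.map f).foldr max (f ∅) := by
    rw [mul_comm]; rfl
  rw [h2, h1]
  refine foldr_max_eq (h.mono (Finset.empty_subset _) subset_rfl) ?_ ?_
  · intro b hb
    obtain ⟨A, hA, rfl⟩ := List.mem_map.1 hb
    exact h.mono (hS A hA) subset_rfl
  · obtain ⟨A, hA, hAf⟩ := hf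
    exact List.mem_map.2 ⟨A, hA, hAf⟩

/-- Seeds of the machines, reordered by iterations and samples. -/
def seedEquiv (k T r D N : ℕ) :
    (Fin k → Fin (T + 1) → Fin r → Fin (D + 1) → Fin N.factorial) ≃
      (Fin (T + 1) → Fin r → Fin k × Fin (D + 1) → Fin N.factorial) where
  toFun s t q a := s a.1 t q a.2
  invFun ω i t q l := ω t q (i, l)
  left_inv _ := rfl
  right_inv _ := rfl

end Protocol

/-! ### The success probability. -/

section Success

variable {X : Type u} {R : Type v} [LinearOrder R] [Fintype X] [Nonempty X] {k r N : ℕ} [NeZero k]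
  {region : X → Set R} {f : Finset X → R} {M d D : ℕ}
  {enc : ℕ × (Fin r → X) → List Bool} {dec : List Bool → ℕ × (Fin r → X)}

lemma protocol_successProb {ν τ : ℕ} {part : Fin k → Finset X} {S : Finset X}
    (hS : S.Nonempty) (hpart : IsInputPartition part S) (h : LPType.HasRegions region f S)
    (hν : LPType.combDim f S ≤ ν) (hν1 : 1 ≤ ν) (hτ : 1 ≤ τ) (hM : 0 < M) (hD : 0 < D)
    (hk : k ≤ d ^ D) (hr : ν ^ 2 * M ≤ r + 1) (hN : S.card * M ^ (ν * τ) ≤ N)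
    (hdec : ∀ m, m.1 ≤ N → dec (enc m) = m) :
    1 - (S.card : ℝ) * (((ν : ℝ) + 1) / ν) ^ (ν * τ) / (M : ℝ) ^ τ
      ≤ (protocol region f M d D (ν * τ) enc dec k N).successProb part (f S) := by
  classical
  have : Nonempty (Fin N.factorial) := ⟨⟨0, N.factorial_pos⟩⟩
  set P := protocol region f M d D (ν * τ) enc dec k N with hP
  have hs := isExactSampler_treeSample (N := N) (parent d) part hS hpart
    (iterate_parent_eq_zero d hk) hN
  have hfail := card_failures_le (r := r) h hν hν1 hτ hM hr hs
  set Ω := Fin (ν * τ + 1) → Fin r → Fin k × Fin (D + 1) → Fin N.factorial with hΩ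
  set bad : Finset Ω := Finset.univ.filter fun ω =>
    ∀ A ∈ samples region f M (fun w η => treeSample (parent d) part w N D η D 0)
      (fun s => ω (Fin.ofNat (ν * τ + 1) s)) (ν * τ), f A ≠ f S with hbad
  -- Seeds are regrouped by iteration and sample; each seed for which some sample attains `f S`
  -- makes all machines succeed.
  have hgood : badᶜ.card ≤ Nat.card {seed : Fin k → P.Seed // ∀ i, P.result part seed i = f S} := by
    let e := seedEquiv k (ν * τ) r D N
    have hfin : Finite (Fin k → P.Seed) := Finite.of_equiv _ e.symm
    rw [← Fintype.card_coe, ← Nat.card_eq_fintype_card]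
    refine Nat.card_le_card_of_injective (fun ω => ⟨e.symm ω.1, fun i => ?_⟩) ?_
    · have hω := ω.2
      simp only [hbad, Finset.mem_compl, Finset.mem_filter,
        Finset.mem_univ, true_and, not_forall, not_not] at hω
      obtain ⟨A, hA, hAf⟩ := hω
      exact protocol_result region f M d D (ν * τ) enc dec part (e.symm ω.1) h hM hD hk hpart hN
        hdec (fun A hA => samples_subset hM hs _ le_rfl hA) ⟨A, hA, hAf⟩ i
    · intro a b hab
      exact Subtype.ext (e.symm.injective (congrArg Subtype.val hab))
  have htotal : Nat.card (Fin k → P.Seed) = Fintype.card Ω := by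
    rw [← Nat.card_eq_fintype_card]
    exact Nat.card_congr (seedEquiv k (ν * τ) r D N)
  have hcompl : bad.card + badᶜ.card = Fintype.card Ω := Finset.card_add_card_compl bad
  have hΩpos : (0 : ℝ) < Fintype.card Ω := by exact_mod_cast Fintype.card_pos
  have hνpos : (0 : ℝ) < ν := by exact_mod_cast hν1
  have hMpos : (0 : ℝ) < M := by exact_mod_cast hM
  have hfail' : (bad.card : ℝ)
      ≤ (S.card : ℝ) * (((ν : ℝ) + 1) / ν) ^ (ν * τ) / (M : ℝ) ^ τ * Fintype.card Ω := by
    have h1 : (ν : ℝ) ^ (ν * τ) * ((M : ℝ) ^ τ * bad.card)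
        ≤ ((ν : ℝ) + 1) ^ (ν * τ) * (S.card * Fintype.card Ω) := by exact_mod_cast hfail
    rw [div_pow, mul_div_assoc', div_div, div_mul_eq_mul_div, le_div_iff₀ (by positivity)]
    linarith
  have hgood' : (Fintype.card Ω : ℝ) - bad.card
      ≤ Nat.card {seed : Fin k → P.Seed // ∀ i, P.result part seed i = f S} := by
    have h1 : Fintype.card Ω ≤ bad.card
        + Nat.card {seed : Fin k → P.Seed // ∀ i, P.result part seed i = f S} := by omega
    have h2 : (Fintype.card Ω : ℝ) ≤ bad.card
        + Nat.card {seed : Fin k → P.Seed // ∀ i, P.result part seed i = f S} := by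
      exact_mod_cast h1
    linarith
  rw [MPCProtocol.successProb, htotal, le_div_iff₀ hΩpos, sub_mul, one_mul]
  linarith

end Success

/-! ### Choice of parameters. -/

section Parameters

/-- From `1 + x ≤ exp x` and `e < 3`. -/
lemma add_one_div_pow_le (ν τ : ℕ) (hν : 1 ≤ ν) :
    (((ν : ℝ) + 1) / ν) ^ (ν * τ) ≤ 3 ^ τ := by
  have hν0 : (0 : ℝ) < ν := by exact_mod_cast hν
  rw [pow_mul]
  refine pow_le_pow_left₀ (by positivity) ?_ τ
  have h1 : ((ν : ℝ) + 1) / ν ≤ Real.exp (1 / ν) := by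
    rw [add_div, div_self hν0.ne', add_comm]
    exact Real.add_one_le_exp _
  calc (((ν : ℝ) + 1) / ν) ^ ν ≤ Real.exp (1 / ν) ^ ν := pow_le_pow_left₀ (by positivity) h1 ν
    _ = Real.exp 1 := by rw [← Real.exp_nat_mul, mul_one_div_cancel hν0.ne']
    _ ≤ 3 := by linarith [Real.exp_one_lt_d9]

/-- The parameters of the algorithm: the branching factor (and reweighting factor) `M`, the depth
`D` of the tree, the number `τ` of iterations per basis element, and a bound `g` on the number of
bits of `M`. -/
lemma exists_parameters {c δ : ℝ} (hc : 1 ≤ c) (hδ : 0 < δ) (hδ1 : δ < 1) {n b : ℕ} (hn : 2 ≤ n)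
    (hb : n ≤ 2 ^ b) : ∃ M D τ g : ℕ, 0 < M ∧ 0 < D ∧ 1 ≤ τ ∧ n ≤ M ^ D ∧ M ≤ 2 ^ g ∧
      (M : ℝ) ^ 2 ≤ 768 * (n : ℝ) ^ δ ∧ (τ : ℝ) * (2 * D) ≤ 16 * (c + 2) / δ ^ 2 ∧
      (τ : ℝ) * g ≤ 11 * (c + 2) * b ∧ (n : ℝ) * 3 ^ τ / (M : ℝ) ^ τ ≤ 1 / (n : ℝ) ^ c := by
  have hn2 : (2 : ℝ) ≤ n := by exact_mod_cast hn
  have hn0 : (0 : ℝ) < n := by linarith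
  have hn1 : (1 : ℝ) ≤ n := by linarith
  have hl2 : 0.69 < Real.log 2 := by linarith [Real.log_two_gt_d9]
  have hl2' : Real.log 2 < 0.7 := by linarith [Real.log_two_lt_d9]
  set ℓ := Real.log n with hℓ
  have hℓ2 : Real.log 2 ≤ ℓ := Real.log_le_log (by norm_num) hn2
  have hℓ0 : 0 < ℓ := by linarith
  have hℓb : ℓ ≤ b * Real.log 2 := by
    rw [← Real.log_pow]
    exact Real.log_le_log hn0 (by exact_mod_cast hb)
  -- Here `δ₀ = max δ (1 / log n)`. Raising a tiny `δ` costs at most a factor `n ^ (1 / log n) = e <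
  -- 3` and keeps `1 / δ₀` of order `b`.
  obtain ⟨δ₀, hδ₀, hδ₀δ, hδ₀ℓ, hδ₀2, hnδ⟩ : ∃ δ₀ : ℝ, 0 < δ₀ ∧ δ ≤ δ₀ ∧ 1 ≤ δ₀ * ℓ ∧ δ₀ ≤ 2 ∧
      (n : ℝ) ^ δ₀ ≤ 3 * (n : ℝ) ^ δ := by
    have hpos : 0 < (n : ℝ) ^ δ := Real.rpow_pos_of_pos hn0 _
    rcases le_total (1 / ℓ) δ with h | h
    · exact ⟨δ, hδ, le_rfl, (div_le_iff₀ hℓ0).1 h, by linarith, by linarith⟩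
    · refine ⟨1 / ℓ, by positivity, h, (by field_simp; rfl), ?_, ?_⟩
      · rw [div_le_iff₀ hℓ0]; linarith
      · rw [Real.rpow_def_of_pos hn0, ← hℓ, mul_one_div_cancel hℓ0.ne']
        have := Real.one_le_rpow hn1 hδ.le
        linarith [Real.exp_one_lt_d9]
  set ε := δ₀ / 2 with hε
  have hε0 : 0 < ε := by positivity
  have hε1 : ε ≤ 1 := by linarith
  have hεinv : 1 ≤ 1 / ε := by rw [le_div_iff₀ hε0]; linarith
  set y := (n : ℝ) ^ ε with hy
  have hy1 : 1 ≤ y := Real.one_le_rpow hn1 hε0.le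
  have hyy : y ^ 2 = (n : ℝ) ^ δ₀ := by
    rw [hy, ← Real.rpow_natCast, ← Real.rpow_mul hn0.le]; congr 1; rw [hε]; push_cast; ring
  -- The factor 8 absorbs the 3 of the weight growth with room to spare; `8⌈y⌉ ≤ 16y` since `y ≥ 1`.
  -- The exponent is halved because the load contains `M ^ 2`.
  set M := 8 * ⌈y⌉₊ with hM
  have hMy : 8 * y ≤ M := by rw [hM]; push_cast; linarith [Nat.le_ceil y]
  have hMy' : (M : ℝ) ≤ 16 * y := by
    rw [hM]; push_cast; linarith [Nat.ceil_lt_add_one (by linarith : 0 ≤ y)]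
  have hM0 : (0 : ℝ) < M := by linarith
  have hpow : ∀ {a : ℝ} {t : ℕ}, a ≤ ε * t → (n : ℝ) ^ a ≤ y ^ t := fun {a t} ha => by
    rw [hy, ← Real.rpow_natCast, ← Real.rpow_mul hn0.le]
    exact Real.rpow_le_rpow_of_exponent_le hn1 ha
  set D := ⌈1 / ε⌉₊ with hD
  set τ := ⌈(c + 1) / ε⌉₊ with hτ
  have hDl : 1 / ε ≤ D := Nat.le_ceil _
  have hDu : (D : ℝ) ≤ 2 / ε := by
    have := Nat.ceil_lt_add_one (by positivity : 0 ≤ 1 / ε)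
    have h2 : (2 : ℝ) / ε = 1 / ε + 1 / ε := by ring
    linarith
  have hτl : (c + 1) / ε ≤ τ := Nat.le_ceil _
  have hτu : (τ : ℝ) ≤ (c + 2) / ε := by
    have := Nat.ceil_lt_add_one (by positivity : 0 ≤ (c + 1) / ε)
    have h2 : (c + 2) / ε = (c + 1) / ε + 1 / ε := by ring
    linarith
  set g := ⌈Real.logb 2 M⌉₊ with hg
  refine ⟨M, D, τ, g, by exact_mod_cast hM0, Nat.ceil_pos.2 (by positivity),
    Nat.ceil_pos.2 (by positivity), ?_, ?_, ?_, ?_, ?_, ?_⟩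
  · have h1 : (n : ℝ) ≤ y ^ D := by
      have := hpow (a := 1) (t := D) (by rwa [mul_comm, ← div_le_iff₀ hε0])
      rwa [Real.rpow_one] at this
    have h2 : y ^ D ≤ (M : ℝ) ^ D := pow_le_pow_left₀ (by linarith) (by linarith) D
    exact_mod_cast h1.trans h2
  · have h1 : (M : ℝ) ≤ 2 ^ (g : ℝ) :=
      (Real.logb_le_iff_le_rpow (by norm_num) hM0).1 (Nat.le_ceil _)
    rw [Real.rpow_natCast] at h1
    exact_mod_cast h1
  · calc (M : ℝ) ^ 2 ≤ (16 * y) ^ 2 := pow_le_pow_left₀ hM0.le hMy' 2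
      _ = 256 * (n : ℝ) ^ δ₀ := by rw [mul_pow, hyy]; norm_num
      _ ≤ _ := by linarith
  · calc (τ : ℝ) * (2 * D) ≤ (c + 2) / ε * (2 * (2 / ε)) := by gcongr
      _ = 16 * (c + 2) / δ₀ ^ 2 := by rw [hε]; field_simp; ring
      _ ≤ _ := by gcongr
  · have h1 : (g : ℝ) ≤ Real.logb 2 M + 1 := by
      refine (Nat.ceil_lt_add_one (Real.logb_nonneg (by norm_num) ?_)).le
      linarith
    have h2 : Real.logb 2 M ≤ 4 + ε * b := by
      have h3 : Real.log M ≤ 4 * Real.log 2 + ε * ℓ := by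
        refine (Real.log_le_log hM0 hMy').trans (le_of_eq ?_)
        rw [Real.log_mul (by norm_num) (by positivity), hy, Real.log_rpow hn0,
          show (16 : ℝ) = 2 ^ 4 by norm_num, Real.log_pow, ← hℓ]
        norm_num
      rw [Real.logb, div_le_iff₀ (by linarith)]
      nlinarith [mul_le_mul_of_nonneg_left hℓb hε0.le]
    -- This is where `1 ≤ δ₀ * ℓ` is needed: the constant term in the bound on `g`, multiplied by
    -- `τ`, stays linear in `b`.
    have h4 : 1 / ε ≤ 2 * (0.7 * b) := by
      rw [div_le_iff₀ hε0, hε]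
      have h5 : δ₀ * ℓ ≤ δ₀ * (b * 0.7) := by
        refine mul_le_mul_of_nonneg_left (hℓb.trans ?_) hδ₀.le
        exact mul_le_mul_of_nonneg_left hl2'.le (Nat.cast_nonneg b)
      linarith
    calc (τ : ℝ) * g ≤ (c + 2) / ε * (5 + ε * b) := by
          gcongr
          linarith
      _ = (c + 2) * (5 * (1 / ε) + b) := by field_simp
      _ ≤ (c + 2) * (5 * (2 * (0.7 * b)) + b) := by gcongr
      _ ≤ _ := by nlinarith [Nat.cast_nonneg (α := ℝ) b]
  · have h1 : (n : ℝ) ^ (c + 1) ≤ y ^ τ := hpow (by rwa [mul_comm, ← div_le_iff₀ hε0])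
    have h2 : (3 : ℝ) ^ τ * y ^ τ ≤ (M : ℝ) ^ τ := by
      rw [← mul_pow]
      exact pow_le_pow_left₀ (by positivity) (by linarith) τ
    rw [Real.rpow_add hn0, Real.rpow_one] at h1
    have hnc : 0 < (n : ℝ) ^ c := Real.rpow_pos_of_pos hn0 _
    rw [div_le_div_iff₀ (by positivity) hnc, one_mul]
    calc (n : ℝ) * 3 ^ τ * (n : ℝ) ^ c = 3 ^ τ * ((n : ℝ) ^ c * n) := by ring
      _ ≤ 3 ^ τ * y ^ τ := by gcongr
      _ ≤ _ := h2

end Parameters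

end MPCSampling

/-! ### Degenerate cases and the main theorem. -/

/-- The protocol without communication in which every machine outputs `v`. -/
def MPCProtocol.const (k : ℕ) (X : Type u) {R : Type v} (v : R) : MPCProtocol k X R where
  rounds := 0
  Seed := Unit
  finite_seed := inferInstance
  nonempty_seed := inferInstance
  send _ _ _ _ _ := []
  output _ _ _ _ := v

lemma MPCProtocol.loadAtMost_const {k : ℕ} {X : Type u} {R : Type v} (v : R)
    (part : Fin k → Finset X) (seed : Fin k → (MPCProtocol.const k X v).Seed) (L : ℝ) :
    (MPCProtocol.const k X v).LoadAtMost part seed L :=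
  fun t ht => absurd ht (Nat.not_lt_zero t)

lemma MPCProtocol.successProb_const {k : ℕ} {X : Type u} {R : Type v} (v : R)
    (part : Fin k → Finset X) : (MPCProtocol.const k X v).successProb part v = 1 := by
  have h : Nat.card {seed : Fin k → (MPCProtocol.const k X v).Seed //
      ∀ i, (MPCProtocol.const k X v).result part seed i = v}
      = Nat.card (Fin k → (MPCProtocol.const k X v).Seed) :=
    Nat.card_congr (Equiv.subtypeUnivEquiv fun _ _ => rfl)
  have h1 : Nat.card (Fin k → (MPCProtocol.const k X v).Seed) = 1 := by
    simp [MPCProtocol.const]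
  rw [MPCProtocol.successProb, h, h1]
  norm_num

/-- If all bases are empty, then every optimum is the optimum of the empty set. -/
lemma LPType.HasRegions.eq_empty_of_combDim {X : Type u} {R : Type v} [LinearOrder R]
    {region : X → Set R} {f : Finset X → R} {S : Finset X} (h : LPType.HasRegions region f S)
    (h0 : LPType.combDim f S = 0) : f S = f ∅ := by
  obtain ⟨B, hB, hcard⟩ := h.exists_isBasis (subset_refl S)
  rw [h0, Nat.le_zero, Finset.card_eq_zero] at hcard
  rw [← hB.2.1, hcard]

theorem mainTheorem7 :
    ∃ a : ℕ, ∀ c : ℝ, 1 ≤ c → ∃ K : ℝ, 0 < K ∧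
      ∀ (X : Type u) (R : Type v) [DecidableEq X] [LinearOrder R]
        -- publicly known: the constraints, coded by `b` bits each, and the function `f`
        (b : ℕ) (_code : X ↪ (Fin b → Bool)) (region : X → Set R) (f : Finset X → R)
        (n k ν lam : ℕ) (δ : ℝ),
        1 ≤ k → k ≤ n → 1 ≤ lam → 0 < δ → δ < 1 →
        ∃ P : MPCProtocol k X R,
          (P.rounds : ℝ) ≤ K * ((ν : ℝ) / δ ^ 2) ∧
          -- the input: `n` constraints, arbitrarily partitioned among the `k` machines
          ∀ (S : Finset X) (part : Fin k → Finset X),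
            S.card = n →
            IsInputPartition part S →
            LPType.IsLPType f S →
            LPType.HasRegions region f S →
            LPType.combDim f S ≤ ν →
            LPType.vcDim (region '' (S : Set X)) ≤ (lam : ℕ∞) →
            (∀ seed : Fin k → P.Seed,
              P.LoadAtMost part seed
                (K * (((lam : ℝ) * (n : ℝ) ^ δ * (ν : ℝ) ^ 2) *
                  Real.log ((lam : ℝ) * (n : ℝ) ^ δ * (ν : ℝ) ^ 2 + 2) ^ a) * (b : ℝ))) ∧
            1 - 1 / (n : ℝ) ^ c ≤ P.successProb part (f S) := by
  -- No logarithmic factor is needed. In `K`, 768 comes from the bound on `M ^ 2`, and `11c + 25 =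
  -- 11(c + 2) + 3` from the four summands of `L`.
  refine ⟨0, fun c hc => ⟨768 * (11 * c + 25), by positivity, ?_⟩⟩
  intro X R _ _ b code region f n k ν lam δ hk hkn hlam hδ hδ1
  have hconst : ∀ v : R, (((MPCProtocol.const k X v).rounds : ℕ) : ℝ)
      ≤ 768 * (11 * c + 25) * ((ν : ℝ) / δ ^ 2) := fun v => by
    simp only [MPCProtocol.const, Nat.cast_zero]
    positivity
  rcases Nat.eq_zero_or_pos ν with rfl | hν
  · refine ⟨MPCProtocol.const k X (f ∅), hconst _, fun S part _ _ _ hreg hdim _ =>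
      ⟨fun seed => MPCProtocol.loadAtMost_const _ part seed _, ?_⟩⟩
    rw [hreg.eq_empty_of_combDim (Nat.le_zero.1 hdim), MPCProtocol.successProb_const]
    have : (0 : ℝ) ≤ 1 / (n : ℝ) ^ c := by positivity
    linarith
  -- For `n = 1` the required success probability is `0`.
  by_cases hn : n < 2
  · have hn1 : n = 1 := by omega
    refine ⟨MPCProtocol.const k X (f ∅), hconst _, fun S part _ _ _ _ _ _ =>
      ⟨fun seed => MPCProtocol.loadAtMost_const _ part seed _, ?_⟩⟩
    rw [hn1, Nat.cast_one, Real.one_rpow, div_one, sub_self]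
    exact div_nonneg (Nat.cast_nonneg _) (Nat.cast_nonneg _)
  have : Fintype X := Fintype.ofInjective code code.injective
  have hXb : Fintype.card X ≤ 2 ^ b := by
    simpa using Fintype.card_le_of_injective code code.injective
  by_cases hnX : Fintype.card X < n
  · refine ⟨MPCProtocol.const k X (f ∅), hconst _, fun S part hS => ?_⟩
    exact absurd (Finset.card_le_univ S) (by omega)
  have : Nonempty X := Fintype.card_pos_iff.1 (by omega)
  have : NeZero k := ⟨by omega⟩
  obtain ⟨M, D, τ, g, hM, hD, hτ, hnM, hMg, hM2, hrounds, hτg, hfail⟩ :=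
    MPCSampling.exists_parameters hc hδ hδ1 (by omega : 2 ≤ n) (by omega : n ≤ 2 ^ b)
  -- Bounds the total weight, since each of the `n` weights grows at most `ν * τ` times.
  set N := n * M ^ (ν * τ) with hN
  set r := ν ^ 2 * M with hr
  -- The first three terms code a weight up to `N`, the last one `r` constraints.
  set L := 1 + b + ν * τ * g + b * r with hL
  have hNL : (N + 1) * Fintype.card X ^ r ≤ 2 ^ L := by
    have h1 : N + 1 ≤ 2 ^ (1 + b + ν * τ * g) := by
      have h2 : 1 ≤ N := Nat.mul_pos (by omega) (pow_pos hM _)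
      have h3 : N ≤ 2 ^ b * (2 ^ g) ^ (ν * τ) :=
        Nat.mul_le_mul (by omega) (Nat.pow_le_pow_left hMg _)
      rw [← pow_mul, ← pow_add, mul_comm g] at h3
      rw [add_assoc, pow_add, pow_one]
      omega
    rw [hL, pow_add, pow_mul 2 b r]
    exact Nat.mul_le_mul h1 (Nat.pow_le_pow_left hXb _)
  obtain ⟨enc, dec, hlen, hdec⟩ := MPCSampling.exists_msg_code N r L hNL
  have hν1 : (1 : ℝ) ≤ ν := by exact_mod_cast hν
  have hM1 : (1 : ℝ) ≤ M := by exact_mod_cast hM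
  have hlam1 : (1 : ℝ) ≤ lam := by exact_mod_cast hlam
  have hb1 : (1 : ℝ) ≤ b := by
    have : b ≠ 0 := fun h => by simp [h] at hXb; omega
    exact_mod_cast Nat.one_le_iff_ne_zero.2 this
  have hnδ : 0 < (n : ℝ) ^ δ :=
    Real.rpow_pos_of_pos (by exact_mod_cast (by omega : 0 < n)) _
  have hload : ((M * L : ℕ) : ℝ) ≤ 768 * (11 * c + 25) *
      (((lam : ℝ) * (n : ℝ) ^ δ * (ν : ℝ) ^ 2) *
        Real.log ((lam : ℝ) * (n : ℝ) ^ δ * (ν : ℝ) ^ 2 + 2) ^ 0) * (b : ℝ) := by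
    have hν2 : (ν : ℝ) ≤ (ν : ℝ) ^ 2 * M := by 
      rw [pow_two, mul_assoc]
      exact le_mul_of_one_le_right (by positivity) (one_le_mul_of_one_le_of_one_le hν1 hM1)
    have h1 : (1 : ℝ) ≤ (ν : ℝ) ^ 2 * M := hν1.trans hν2
    have hLb : (L : ℝ) ≤ (11 * c + 25) * ((ν : ℝ) ^ 2 * M) * b := by
      rw [hL, hr]
      push_cast
      have h2 : (ν : ℝ) * τ * g ≤ (ν : ℝ) ^ 2 * M * (11 * (c + 2) * b) := by
        rw [mul_assoc]
        exact mul_le_mul hν2 hτg (by positivity) (by positivity)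
      have h3 : (b : ℝ) ≤ (ν : ℝ) ^ 2 * M * b := le_mul_of_one_le_left (by positivity) h1
      linarith
    push_cast
    calc (M : ℝ) * L ≤ M * ((11 * c + 25) * ((ν : ℝ) ^ 2 * M) * b) := by gcongr
      _ = (11 * c + 25) * ((ν : ℝ) ^ 2 * (M : ℝ) ^ 2) * b := by ring
      _ ≤ (11 * c + 25) * ((ν : ℝ) ^ 2 * (lam * (768 * (n : ℝ) ^ δ))) * b := by
        gcongr
        exact hM2.trans (le_mul_of_one_le_left (by positivity) hlam1)
      _ = _ := by ring
  refine ⟨MPCSampling.protocol region f M M D (ν * τ) enc dec k N, ?_,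
    fun S part hS hpart _ hreg hdim _ => ⟨fun seed t ht i => ?_, ?_⟩⟩
  · have h1 : (((MPCSampling.protocol region f M M D (ν * τ) enc dec k N).rounds : ℕ) : ℝ)
        = ν * ((τ : ℝ) * (2 * D)) := by
      simp only [MPCSampling.protocol]; push_cast; ring
    rw [h1]
    calc (ν : ℝ) * ((τ : ℝ) * (2 * D)) ≤ ν * (16 * (c + 2) / δ ^ 2) := by gcongr
      _ = 16 * (c + 2) * (ν / δ ^ 2) := by ring
      _ ≤ _ := mul_le_mul_of_nonneg_right (by linarith) (by positivity)
  · have := MPCSampling.protocol_load region f M M D (ν * τ) enc dec hlen hM part seed t ht i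
    exact ⟨this.1.trans hload, this.2.trans hload⟩
  · have hSne : S.Nonempty := Finset.card_pos.1 (by omega)
    refine le_trans ?_ (MPCSampling.protocol_successProb hSne hpart hreg hdim hν hτ hM hD
      (hkn.trans hnM) (Nat.le_succ _) (by rw [hS]) hdec)
    rw [hS]
    have h1 : (n : ℝ) * (((ν : ℝ) + 1) / ν) ^ (ν * τ) / (M : ℝ) ^ τ
        ≤ (n : ℝ) * 3 ^ τ / (M : ℝ) ^ τ := by
      gcongr
      exact MPCSampling.add_one_div_pow_le ν τ hν
    linarith
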